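/- Let $\mathbb T=\mathbb R/\mathbb Z$, and let $\|\cdot\|$ denote the usual (flat) metric of $\mathbb T$ and of $\mathbb T^2$. The following objects are fixed: a minimal rotation $T(x,y)=(x+a,y+b)$ of $\mathbb T^2$; a point $z_0\in\mathbb T^2$, with $z_{2n}=T^nz_0$ and $z_{2n+1}=T^{-n-1}z_0$ for $n\ge 0$, and $z_n=(x_n,y_n)$; the bijections $\sigma,\tau$ of $\mathbb N$ with $Tz_n=z_{\sigma(n)}$ and $T^{-1}z_n=z_{\tau(n)}$; numbers $1=\epsilon_0>\epsilon_1>\cdots>0$ with $\epsilon_k\to0$; subdivisions $\epsilon_{k+1}=c_{k,0}<c_{k,1}<c_{k,2}<c_{k,3}<c_{k,4}=\epsilon_k$; and a dense sequence $(q_k)_{k\ge0}$ in $[0,1]$. Put $X=(\mathbb T\setminus\{x_n:n\ge0\})\times\mathbb T$. **The maps $h^\alpha_t$.** For $\alpha\in[0,1]^{\mathbb N}$ let $p_\alpha:(0,1]\to\mathbb R$ be the continuous function that equals $q_0/4$ on $[c_{0,0},c_{0,1}]$ and $\alpha(0)/4$ on $[c_{0,2},c_{0,3}]$, equals $\alpha(k)/4$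 on $[c_{k,0},c_{k,1}]$ and $q_k/4$ on $[c_{k,2},c_{k,3}]$ for $k\ge1$, has $p_\alpha(1)=-1/4$, and is affine on each $[c_{k,1},c_{k,2}]$ and $[c_{k,3},c_{k,4}]$. For $0<t\le1$ let $h^\alpha_t:[-1,1]\to[-1,1]$ be the function whose graph is the polyline through $$(-1,-1),\ \left(-\tfrac{1+t}2,-t\right),\ \left(-\tfrac12,-\tfrac t2\right),\ \left(-p_\alpha(t),\tfrac t4\right),\ \left(\tfrac12,\tfrac t2\right),\ \left(\tfrac{1+t}2,t\right),\ (1,1),$$ let $h^\alpha_0$ be the polyline through $(-1,-1),(-\frac12,0),(\frac12,0),(1,1)$, and put $h^\alpha_{-t}=h^\alpha_t$. **The maps $\Phi_\alpha$.** For positive numbers $\delta_n=\delta_{\alpha,n}$ let $A_{\alpha,n}=\{z_n+(t,s):|t|,|s|\le\delta_{n}\}$, let $$\Lambda_{\alpha,n}(z_n+(t,s))=z_n+\bigl(t,\ h^\alpha_t\bigl((h^\alpha_{\delta_{n}})^{-1}(s)\bigr)\bigr)\qquad(|t|,|s|\le\delta_{n}),$$ let $\Lambda_{\alpha,n}$ be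 the identity off $A_{\alpha,n}$, and let $\Phi_{\alpha,n}=\Lambda_{\alpha,n}\circ\cdots\circ\Lambda_{\alpha,0}$, $\Phi^\sigma_{\alpha,n}=\Lambda_{\alpha,\sigma(n)}\circ\cdots\circ\Lambda_{\alpha,\sigma(0)}$ and $\Phi^\tau_{\alpha,n}=\Lambda_{\alpha,\tau(n)}\circ\cdots\circ\Lambda_{\alpha,\tau(0)}$. The sequence $(\delta_{\alpha,n})_n$ is called admissible for $\alpha$ if: 1. $A_{\alpha,m}\cap A_{\alpha,n}=\emptyset$ whenever $0<|n-m|\le5$; 2. $0<\delta_n<2^{-n}$ for all $n$; for all $m<n$, $A_{\alpha,n}$ is disjoint from $\{x_m\}\times\mathbb T$ and $\delta_n<\|x_m-x_n\|/n$; and for all $n\ge1$ and $u,v\in\{x_n\}\times\mathbb T$, $\|\Phi_{\alpha,n-1}(u)-\Phi_{\alpha,n-1}(v)\|\le\delta_n$ implies $\|u-v\|<1/n$; 3. there are integers $a_n\ge2$ with $\prod_{n\ge1}(1-1/a_n)>0$ such that, for all $m>n\ge1$ and all $u,v\in\mathbb T^2$ with $\|u-v\|\ge1/n$, $$\|\Phi_{\alpha,m}(u)-\Phi_{\alpha,m}(v)\|\ge\prod_{r=n+1}^m(1-1/a_r)\,\|\Phi_{\alpha,n}(u)-\Phi_{\alpha,n}(v)\|;$$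 4. the maps $(\Phi^\sigma_{\alpha,n})^{-1}\circ T\circ\Phi_{\alpha,n}$ and $(\Phi^\tau_{\alpha,n})^{-1}\circ T^{-1}\circ\Phi_{\alpha,n}$ $(n\ge0)$ are uniformly continuous on $X$, and both sequences of maps are uniformly Cauchy on $X$. (Here $(\Phi^\sigma_{\alpha,n})^{-1}$ and $(\Phi^\tau_{\alpha,n})^{-1}$ are the inverses of the bijections of $X$ induced by $\Phi^\sigma_{\alpha,n}$ and $\Phi^\tau_{\alpha,n}$.) Let $\Phi_\alpha=\lim_n\Phi_{\alpha,n}$; it restricts to a bijection of $X$. **Lemma.** Let $\alpha,\beta\in[0,1]^{\mathbb N}$, and let $(\delta_{\alpha,n})_n$ and $(\delta_{\beta,n})_n$ be admissible for $\alpha$ and $\beta$ respectively. Then $\Phi_\alpha^{-1}\circ T\circ\Phi_\alpha$ and $\Phi_\beta^{-1}\circ T\circ\Phi_\beta$, as self-maps of $X$, extend to unique homeomorphisms $S_\alpha$ and $S_\beta$ of $\mathbb T^2$. Moreover, for any sequences $(w_n)_{n\ge0}$, $(w'_n)_{n\ge0}$ in $\mathbb T^2$ with $\Phi_\alpha(w_n)=\Phi_\beta(w'_n)=T^nz_0=z_{2n}$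 for all $n\ge 0$, the homeomorphisms $S_\alpha$ and $S_\beta$ are topologically conjugate if and only if $(w_n)\,E_{\rm tt}\,(w'_n)$, that is, for every strictly increasing sequence $(r_k)$ of natural numbers, $(w_{r_k})_k$ converges if and only if $(w'_{r_k})_k$ converges. -/

import Mathlib

open Set Filter Topology

noncomputable section

/-- Two sequences have the same convergent subsequences. -/
def Ett {X : Type*} [TopologicalSpace X] (x y : ℕ → X) : Prop :=
  ∀ r : ℕ → ℕ, StrictMono r →
    ((∃ a, Tendsto (fun k => x (r k)) atTop (𝓝 a)) ↔
      (∃ b, Tendsto (fun k => y (r k)) atTop (𝓝 b)))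

/-- Topological conjugacy of two homeomorphisms. -/
def TopConjugate {X Y : Type*} [TopologicalSpace X] [TopologicalSpace Y]
    (f : X ≃ₜ X) (g : Y ≃ₜ Y) : Prop :=
  ∃ φ : X ≃ₜ Y, ∀ x, φ (f x) = g (φ x)

namespace DenjoyRees

/-- The torus, with circle `ℝ / ℤ`. -/
abbrev Torus : Type := UnitAddCircle × UnitAddCircle

/-- The flat (Euclidean) metric of the torus. -/
def tdist (z w : Torus) : ℝ := Real.sqrt (dist z.1 w.1 ^ 2 + dist z.2 w.2 ^ 2)

/-- The representative in `[-1/2, 1/2)` of a point of the circle. -/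
def rep (x : UnitAddCircle) : ℝ := (AddCircle.equivIco (1 : ℝ) (-1 / 2) x : ℝ)

/-- The value at `s` of the affine function through `(x₀, y₀)` and `(x₁, y₁)`. -/
def seg (x₀ y₀ x₁ y₁ s : ℝ) : ℝ := y₀ + (y₁ - y₀) / (x₁ - x₀) * (s - x₀)

/-- The objects that are fixed once and for all, before any parameter sequence is considered. -/
structure Setup where
  /-- the translation vector `(a, b)` of the rotation -/
  v : Torus
  /-- the rotation by `v` is minimal: all its orbits are dense -/
  minimal : ∀ z : Torus, Dense (Set.range fun n : ℤ => z + n • v)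
  /-- the base point of the fixed orbit -/
  z₀ : Torus
  /-- a decreasing sequence `1 = ε 0 > ε 1 > ⋯` of positive numbers with limit `0` -/
  ε : ℕ → ℝ
  ε_pos : ∀ k, 0 < ε k
  ε_zero : ε 0 = 1
  ε_anti : StrictAnti ε
  ε_lim : Tendsto ε atTop (𝓝 0)
  /-- the subdivision of `[ε (k+1), ε k]` into four intervals `[c k i, c k (i+1)]` -/
  c : ℕ → Fin 5 → ℝ
  c_mono : ∀ k, StrictMono (c k)
  c_zero : ∀ k, c k 0 = ε (k + 1)
  c_four : ∀ k, c k 4 = ε k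
  /-- a dense sequence in `[0, 1]` -/
  q : ℕ → unitInterval
  q_dense : DenseRange q

/-- `T z_n = z_{σ n}`. -/
def sigma (n : ℕ) : ℕ := if n % 2 = 0 then n + 2 else if n = 1 then 0 else n - 2

/-- `T⁻¹ z_n = z_{τ n}`. -/
def tau (n : ℕ) : ℕ := if n % 2 = 1 then n + 2 else if n = 0 then 1 else n - 2

namespace Setup

variable (D : Setup)

/-- The rotation `T`. -/
def T (z : Torus) : Torus := z + D.v

/-- The inverse rotation. -/
def Tinv (z : Torus) : Torus := z - D.v

/-- `z_{2m} = T^m z₀` and `z_{2m+1} = T^{-m-1} z₀`. -/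
def z (n : ℕ) : Torus :=
  if n % 2 = 0 then D.z₀ + (n / 2) • D.v else D.z₀ - (n / 2 + 1) • D.v

/-- The torus without the vertical circles through the points `z_n`. -/
def X : Set Torus := {w | ∀ n, w.1 ≠ (D.z n).1}

/-- The value of `p_α` on the first (lowest) quarter `[c k 0, c k 1]`. -/
def low (α : ℕ → unitInterval) : ℕ → ℝ
  | 0 => (D.q 0 : ℝ) / 4
  | k + 1 => (α (k + 1) : ℝ) / 4

/-- The value of `p_α` on the third quarter `[c k 2, c k 3]`. -/
def high (α : ℕ → unitInterval) : ℕ → ℝ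
  | 0 => (α 0 : ℝ) / 4
  | k + 1 => (D.q (k + 1) : ℝ) / 4

/-- The value of `p_α` at `ε k`. -/
def top (α : ℕ → unitInterval) : ℕ → ℝ
  | 0 => -1 / 4
  | k + 1 => D.low α k

/-- For `0 < t ≤ 1`, the index `k` with `ε (k+1) < t ≤ ε k`. -/
def level (t : ℝ) : ℕ := sInf {k : ℕ | D.ε (k + 1) < t}

/-- The continuous function `p_α` on `(0, 1]`: constant on the first and third quarters, affine on
the second and fourth ones. -/
def p (α : ℕ → unitInterval) (t : ℝ) : ℝ :=
  let k := D.level t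
  if t ≤ D.c k 1 then D.low α k
  else if t ≤ D.c k 2 then seg (D.c k 1) (D.low α k) (D.c k 2) (D.high α k) t
  else if t ≤ D.c k 3 then D.high α k
  else seg (D.c k 3) (D.high α k) (D.c k 4) (D.top α k) t

/-- For `0 < t ≤ 1`, the polyline `h^α_t` through `(-1, -1)`, `(-(1+t)/2, -t)`, `(-1/2, -t/2)`,
`(-p_α(t), t/4)`, `(1/2, t/2)`, `((1+t)/2, t)`, `(1, 1)`. For `t = 0` this is the polyline through
`(-1, -1)`, `(-1/2, 0)`, `(1/2, 0)`, `(1, 1)`. -/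
def hpos (α : ℕ → unitInterval) (t s : ℝ) : ℝ :=
  if s ≤ -(1 + t) / 2 then seg (-1) (-1) (-(1 + t) / 2) (-t) s
  else if s ≤ -1 / 2 then seg (-(1 + t) / 2) (-t) (-1 / 2) (-t / 2) s
  else if s ≤ -D.p α t then seg (-1 / 2) (-t / 2) (-D.p α t) (t / 4) s
  else if s ≤ 1 / 2 then seg (-D.p α t) (t / 4) (1 / 2) (t / 2) s
  else if s ≤ (1 + t) / 2 then seg (1 / 2) (t / 2) ((1 + t) / 2) t s
  else seg ((1 + t) / 2) t 1 1 s

/-- The function `h^α`, even in `t`. -/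
def h (α : ℕ → unitInterval) (t s : ℝ) : ℝ := D.hpos α |t| s

/-- The inverse of `h^α_t` as a self-map of `[-1, 1]`. -/
def hinv (α : ℕ → unitInterval) (t : ℝ) : ℝ → ℝ :=
  Function.invFunOn (D.h α t) (Set.Icc (-1) 1)

/-- The square with centre `z_n` and side `2 * d`. -/
def A (d : ℝ) (n : ℕ) : Set Torus :=
  {w | ∃ t s : ℝ, |t| ≤ d ∧ |s| ≤ d ∧ w = D.z n + ((t : UnitAddCircle), (s : UnitAddCircle))}

open Classical in
/-- The map `Λ_{α,n}`: `z_n + (t, s) ↦ z_n + (t, h^α_t ((h^α_d)⁻¹ s))` for `|t|, |s| ≤ d`, and the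
identity outside this square; here `d < 1/2` is the half side of the square. -/
def Lam (α : ℕ → unitInterval) (d : ℝ) (n : ℕ) (w : Torus) : Torus :=
  if w ∈ D.A d n then
    (w.1, (D.z n).2 +
      ((D.h α (rep (w.1 - (D.z n).1)) (D.hinv α d (rep (w.2 - (D.z n).2))) : ℝ) : UnitAddCircle))
  else w

/-- The composition `Λ_{α,e(n)} ∘ ⋯ ∘ Λ_{α,e(1)} ∘ Λ_{α,e(0)}`. -/
def PhiAlong (α : ℕ → unitInterval) (δ : ℕ → ℝ) (e : ℕ → ℕ) : ℕ → Torus → Torus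
  | 0 => D.Lam α (δ (e 0)) (e 0)
  | n + 1 => D.Lam α (δ (e (n + 1))) (e (n + 1)) ∘ PhiAlong α δ e n

/-- The map `Φ_{α,n} = Λ_{α,n} ∘ ⋯ ∘ Λ_{α,0}`. -/
def PhiN (α : ℕ → unitInterval) (δ : ℕ → ℝ) (n : ℕ) : Torus → Torus :=
  D.PhiAlong α δ id n

/-- The map `(Φ^σ_{α,n})⁻¹ ∘ T ∘ Φ_{α,n}` on `X`. -/
def fwd (α : ℕ → unitInterval) (δ : ℕ → ℝ) (n : ℕ) : Torus → Torus :=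
  Function.invFunOn (D.PhiAlong α δ sigma n) D.X ∘ D.T ∘ D.PhiN α δ n

/-- The map `(Φ^τ_{α,n})⁻¹ ∘ T⁻¹ ∘ Φ_{α,n}` on `X`. -/
def bwd (α : ℕ → unitInterval) (δ : ℕ → ℝ) (n : ℕ) : Torus → Torus :=
  Function.invFunOn (D.PhiAlong α δ tau n) D.X ∘ D.Tinv ∘ D.PhiN α δ n

/-- The requirements on the half sides `δ n` of the squares in the construction with parameter
sequence `α`. -/
structure Admissible (α : ℕ → unitInterval) (δ : ℕ → ℝ) : Prop where
  pos : ∀ n, 0 < δ n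
  lt_pow : ∀ n, δ n < 1 / 2 ^ n
  /-- squares with close indices are disjoint -/
  disjoint : ∀ m n, m < n → n ≤ m + 5 → Disjoint (D.A (δ m) m) (D.A (δ n) n)
  /-- a square does not meet the vertical circles through the earlier points -/
  column : ∀ m n, m < n → Disjoint {w : Torus | w.1 = (D.z m).1} (D.A (δ n) n)
  lt_dist : ∀ m n, m < n → δ n < dist (D.z m).1 (D.z n).1 / n
  fibre : ∀ n, ∀ x y : Torus, x.1 = (D.z (n + 1)).1 → y.1 = (D.z (n + 1)).1 →
    tdist (D.PhiN α δ n x) (D.PhiN α δ n y) ≤ δ (n + 1) → tdist x y < 1 / ((n : ℝ) + 1)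
  /-- distances of points are not contracted too much by the later maps -/
  expand : ∃ a : ℕ → ℕ, (∀ n, 2 ≤ a n) ∧
    (∃ l : ℝ, 0 < l ∧
      Tendsto (fun N => ∏ r ∈ Finset.Icc 1 N, (1 - 1 / (a r : ℝ))) atTop (𝓝 l)) ∧
    ∀ n : ℕ, 1 ≤ n → ∀ x y : Torus, 1 / (n : ℝ) ≤ tdist x y → ∀ m, n < m →
      (∏ r ∈ Finset.Ioc n m, (1 - 1 / (a r : ℝ))) * tdist (D.PhiN α δ n x) (D.PhiN α δ n y)
        ≤ tdist (D.PhiN α δ m x) (D.PhiN α δ m y)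
  fwd_unif : ∀ n, UniformContinuousOn (D.fwd α δ n) D.X
  bwd_unif : ∀ n, UniformContinuousOn (D.bwd α δ n) D.X
  fwd_cauchy : UniformCauchySeqOn (D.fwd α δ) atTop D.X
  bwd_cauchy : UniformCauchySeqOn (D.bwd α δ) atTop D.X

/-- The map `Φ_α = lim Φ_{α,n}`. -/
def Phi (α : ℕ → unitInterval) (δ : ℕ → ℝ) (w : Torus) : Torus :=
  limUnder atTop fun n => D.PhiN α δ n w

/-- The homeomorphism `S` of the torus extends the self-map `Φ_α⁻¹ ∘ T ∘ Φ_α` of `X`. -/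
def IsExtension (α : ℕ → unitInterval) (δ : ℕ → ℝ) (S : Torus ≃ₜ Torus) : Prop :=
  Set.EqOn S (Function.invFunOn (D.Phi α δ) D.X ∘ D.T ∘ D.Phi α δ) D.X

end Setup

end DenjoyRees

end

/-! The map `Phi` collapses an orbit's worth of small vertical segments and is otherwise harmless;
this is recorded in `Blowup`. Each `Lam` is a continuous surjection that sends one vertical segment
to `z_n` and is injective elsewhere. The displacements are summable, so the compositions converge
uniformly. The expansion condition carries injectivity off the columns `x_n` to the limit. Later
squares miss the column of `z_n`, so the fibre over `z_n` is decided at stage `n`, and the fibre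
condition makes its diameter tend to `0` (`Admissible.blowup`).

For the extension, squares with close indices are disjoint and their maps commute. Hence along a
subsequence the reordered product `Φ^σ_n` is some `Φ_m` followed by one more `Lam`, so it has the
same limit `Phi`. Passing to the limit in `Φ^σ_n ∘ f_n = T ∘ Φ_n` on the dense set `X` gives `Phi ∘
F = T ∘ Phi`; the same works for `T⁻¹`, and injectivity on `X` makes the two limits mutually inverse
(`Admissible.existsUnique_extension`).

For the conjugacy, lifts of the forward orbit cluster at every point of the torus, and two lifts of
it are asymptotic because the fibres shrink. If the lifts have the same convergent subsequences, the
cluster points of the paired sequence form the graph of a homeomorphism, which intertwines the two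
systems (`Ett.exists_homeomorph`, `Blowup.conjugate_of_ett`). Conversely, a conjugacy covers a
translation of the torus by minimality. It carries a nontrivial fibre to a nontrivial fibre, so the
translation is a power of `T`; correcting by that power gives a homeomorphism over the identity,
which sends one lift asymptotically to the other (`Blowup.exists_lift_of_conjugate`). -/

namespace DenjoyRees

/-! ### Affine pieces; bound and continuity of `p_α`. -/

theorem abs_seg_le {x₀ y₀ x₁ y₁ s C : ℝ} (h : x₀ < x₁) (h₀ : |y₀| ≤ C) (h₁ : |y₁| ≤ C)
    (hs₀ : x₀ ≤ s) (hs₁ : s ≤ x₁) : |seg x₀ y₀ x₁ y₁ s| ≤ C := by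
  have hd : 0 < x₁ - x₀ := sub_pos.2 h
  have e : seg x₀ y₀ x₁ y₁ s = (y₀ * (x₁ - s) + y₁ * (s - x₀)) / (x₁ - x₀) := by
    unfold seg
    field_simp
    ring
  rw [e, abs_div, abs_of_pos hd, div_le_iff₀ hd]
  calc |y₀ * (x₁ - s) + y₁ * (s - x₀)| ≤ |y₀ * (x₁ - s)| + |y₁ * (s - x₀)| := abs_add_le _ _
    _ = |y₀| * (x₁ - s) + |y₁| * (s - x₀) := by
      rw [abs_mul, abs_mul, abs_of_nonneg (sub_nonneg.2 hs₁), abs_of_nonneg (sub_nonneg.2 hs₀)]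
    _ ≤ C * (x₁ - s) + C * (s - x₀) :=
      add_le_add (mul_le_mul_of_nonneg_right h₀ (sub_nonneg.2 hs₁))
        (mul_le_mul_of_nonneg_right h₁ (sub_nonneg.2 hs₀))
    _ = C * (x₁ - x₀) := by ring

theorem seg_left {x₀ y₀ x₁ y₁ : ℝ} : seg x₀ y₀ x₁ y₁ x₀ = y₀ := by simp [seg]

theorem seg_right {x₀ y₀ x₁ y₁ : ℝ} (h : x₀ < x₁) : seg x₀ y₀ x₁ y₁ x₁ = y₁ := by
  have : x₁ - x₀ ≠ 0 := (sub_pos.2 h).ne'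
  unfold seg
  field_simp
  ring

theorem continuous_seg {x₀ y₀ x₁ y₁ : ℝ} : Continuous (seg x₀ y₀ x₁ y₁) := by
  unfold seg
  fun_prop

namespace Setup

variable (D : Setup) (α : ℕ → unitInterval)

/-- The function that `p_α` agrees with on `[ε (k+1), ε k]`. -/
noncomputable def pPiece (k : ℕ) (t : ℝ) : ℝ :=
  if t ≤ D.c k 1 then D.low α k
  else if t ≤ D.c k 2 then seg (D.c k 1) (D.low α k) (D.c k 2) (D.high α k) t
  else if t ≤ D.c k 3 then D.high α k
  else seg (D.c k 3) (D.high α k) (D.c k 4) (D.top α k) t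

theorem abs_unitInterval_div_four (x : unitInterval) : |(x : ℝ) / 4| ≤ 1 / 4 := by
  rw [abs_le]
  constructor <;> linarith [x.2.1, x.2.2]

theorem abs_low_le (k : ℕ) : |D.low α k| ≤ 1 / 4 := by
  cases k <;> exact abs_unitInterval_div_four _

theorem abs_high_le (k : ℕ) : |D.high α k| ≤ 1 / 4 := by
  cases k <;> exact abs_unitInterval_div_four _

theorem abs_top_le (k : ℕ) : |D.top α k| ≤ 1 / 4 := by
  cases k
  · simp only [top]
    rw [abs_le]
    constructor <;> norm_num
  · exact D.abs_low_le α _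

theorem c_lt (k : ℕ) {i j : Fin 5} (h : i < j) : D.c k i < D.c k j := D.c_mono k h

theorem abs_pPiece_le {k : ℕ} {t : ℝ} (h₁ : t ≤ D.ε k) : |D.pPiece α k t| ≤ 1 / 4 := by
  unfold pPiece
  split_ifs with h h' h''
  · exact D.abs_low_le α k
  · exact abs_seg_le (D.c_lt k (by decide)) (D.abs_low_le α k) (D.abs_high_le α k)
      (not_le.1 h).le h'
  · exact D.abs_high_le α k
  · exact abs_seg_le (D.c_lt k (by decide)) (D.abs_high_le α k) (D.abs_top_le α k)
      (not_le.1 h'').le (h₁.trans_eq (D.c_four k).symm)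

theorem continuous_pPiece (k : ℕ) : Continuous (D.pPiece α k) := by
  unfold pPiece
  refine Continuous.if_le continuous_const ?_ continuous_id continuous_const ?_
  · refine Continuous.if_le continuous_seg ?_ continuous_id continuous_const ?_
    · refine Continuous.if_le continuous_const continuous_seg continuous_id continuous_const ?_
      rintro x rfl
      exact seg_left.symm
    · rintro x rfl
      rw [if_pos (D.c_lt k (by decide)).le, seg_right (D.c_lt k (by decide))]
  · rintro x rfl
    rw [if_pos (D.c_lt k (by decide)).le, seg_left]

theorem level_eq {k : ℕ} {t : ℝ} (h : D.ε (k + 1) < t) (h' : t ≤ D.ε k) : D.level t = k := by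
  refine le_antisymm (Nat.sInf_le h) ?_
  by_contra hlt
  have hmem : D.ε (D.level t + 1) < t := Nat.sInf_mem (s := {k : ℕ | D.ε (k + 1) < t}) ⟨k, h⟩
  have : D.ε k ≤ D.ε (D.level t + 1) := D.ε_anti.antitone (by omega)
  linarith

theorem exists_level {t : ℝ} (h₀ : 0 < t) (h₁ : t ≤ 1) : ∃ k, D.ε (k + 1) < t ∧ t ≤ D.ε k := by
  have hex : ∃ k, D.ε k < t := (D.ε_lim.eventually (gt_mem_nhds h₀)).exists
  classical
  obtain ⟨k, hk⟩ : ∃ k, Nat.find hex = k + 1 := by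
    refine Nat.exists_eq_succ_of_ne_zero fun h0 => ?_
    have := Nat.find_spec hex
    rw [h0, D.ε_zero] at this
    linarith
  exact ⟨k, hk ▸ Nat.find_spec hex, not_lt.1 (Nat.find_min hex (by omega))⟩

theorem p_eq_pPiece {k : ℕ} {t : ℝ} (h : D.ε (k + 1) ≤ t) (h' : t ≤ D.ε k) :
    D.p α t = D.pPiece α k t := by
  rcases h.eq_or_lt with rfl | h
  -- The left endpoint has level `k + 1`; the pieces match because `top` at `k + 1` is by definition
  -- `low` at `k`.
  · have hl : D.level (D.ε (k + 1)) = k + 1 := D.level_eq (D.ε_anti (Nat.lt_succ_self _)) le_rfl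
    have e : D.p α (D.ε (k + 1)) = D.pPiece α (k + 1) (D.ε (k + 1)) := by
      unfold p pPiece
      simp only [hl]
    rw [e]
    unfold pPiece
    rw [← D.c_four (k + 1), if_neg (not_le.2 (D.c_lt _ (by decide))),
      if_neg (not_le.2 (D.c_lt _ (by decide))), if_neg (not_le.2 (D.c_lt _ (by decide))),
      seg_right (D.c_lt _ (by decide)), D.c_four, ← D.c_zero, if_pos (D.c_lt _ (by decide)).le]
    rfl
  · unfold p pPiece
    simp only [D.level_eq h h']

theorem abs_p_le {t : ℝ} (h₀ : 0 < t) (h₁ : t ≤ 1) : |D.p α t| ≤ 1 / 4 := by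
  obtain ⟨k, hk, hk'⟩ := D.exists_level h₀ h₁
  rw [D.p_eq_pPiece α hk.le hk']
  exact D.abs_pPiece_le α hk'

theorem continuousOn_p_Icc (N : ℕ) : ContinuousOn (D.p α) (Icc (D.ε N) 1) := by
  induction N with
  | zero => simp [D.ε_zero]
  | succ N ih =>
    have e : Icc (D.ε (N + 1)) 1 = Icc (D.ε (N + 1)) (D.ε N) ∪ Icc (D.ε N) 1 :=
      (Icc_union_Icc_eq_Icc (D.ε_anti (Nat.lt_succ_self _)).le
        (D.ε_zero ▸ D.ε_anti.antitone (Nat.zero_le _))).symm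
    rw [e]
    refine ContinuousOn.union_of_isClosed ?_ ih isClosed_Icc isClosed_Icc
    exact (D.continuous_pPiece α N).continuousOn.congr fun t ht => D.p_eq_pPiece α ht.1 ht.2

theorem continuousAt_p {t : ℝ} (h₀ : 0 < t) (h₁ : t < 1) : ContinuousAt (D.p α) t := by
  obtain ⟨k, hk, -⟩ := D.exists_level h₀ h₁.le
  exact (D.continuousOn_p_Icc α (k + 1)).continuousAt (Icc_mem_nhds hk h₁)

end Setup

/-! ### The polylines `h^α_t` in closed form. -/

/-- A closed form of the polyline through `(-1/2, -1/2)`, `(-p, 1/4)`, `(1/2, 1/2)`, extended by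
constants. -/
noncomputable def bump (p s : ℝ) : ℝ :=
  min (-1 / 2 + 3 / 4 / (1 / 2 - p) * (max (-1 / 2) (min s (1 / 2)) + 1 / 2))
    (1 / 2 + 1 / 4 / (1 / 2 + p) * (max (-1 / 2) (min s (1 / 2)) - 1 / 2))

/-- The difference of two ramps, with slopes `1` and `2`. -/
noncomputable def ramp (t s : ℝ) : ℝ :=
  max 0 (max (s - 1 / 2) (2 * s - 1 - t / 2)) - max 0 (max (-s - 1 / 2) (-2 * s - 1 - t / 2))

/-- A closed form of the polylines `h^α_t`, with `p = p_α(t)`. -/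
noncomputable def polyline (p t s : ℝ) : ℝ := t * bump p s + ramp t s

theorem continuous_ramp : Continuous fun x : ℝ × ℝ => ramp x.1 x.2 := by
  unfold ramp
  fun_prop

theorem monotone_ramp (t : ℝ) : Monotone (ramp t) := by
  intro x y h
  unfold ramp
  refine sub_le_sub (max_le_max le_rfl (max_le_max ?_ ?_)) (max_le_max le_rfl (max_le_max ?_ ?_))
  all_goals linarith

theorem ramp_lt_of_half_le {t x y : ℝ} (ht : 0 ≤ t) (hx : 1 / 2 ≤ x) (h : x < y) :
    ramp t x < ramp t y := by
  have h₁ (s : ℝ) (hs : 1 / 2 ≤ s) : ramp t s = max (s - 1 / 2) (2 * s - 1 - t / 2) := by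
    unfold ramp
    rw [max_eq_right (a := (0 : ℝ)) (le_max_of_le_left (by linarith)), max_eq_left (a := (0 : ℝ))
      (max_le (by linarith) (by linarith)), sub_zero]
  rw [h₁ x hx, h₁ y (hx.trans h.le)]
  exact max_lt_max (by linarith) (by linarith)

theorem ramp_neg (t s : ℝ) : ramp t (-s) = -ramp t s := by
  unfold ramp
  ring_nf

theorem ramp_eq_zero {t s : ℝ} (ht : 0 ≤ t) (hs : |s| ≤ 1 / 2) : ramp t s = 0 := by
  rw [abs_le] at hs
  unfold ramp
  rw [max_eq_left, max_eq_left, sub_zero] <;> apply max_le <;> linarith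

theorem abs_bump_le {p s : ℝ} (hp : |p| ≤ 1 / 4) : |bump p s| ≤ 1 / 2 := by
  rw [abs_le] at hp
  have h₁ : 0 ≤ 3 / 4 / (1 / 2 - p) := div_nonneg (by norm_num) (by linarith)
  have h₂ : 0 ≤ 1 / 4 / (1 / 2 + p) := div_nonneg (by norm_num) (by linarith)
  have h₃ : 1 / 4 / (1 / 2 + p) ≤ 1 := by rw [div_le_one] <;> linarith
  have hc₁ : -1 / 2 ≤ max (-1 / 2) (min s (1 / 2)) := le_max_left _ _
  have hc₂ : max (-1 / 2) (min s (1 / 2)) ≤ 1 / 2 := max_le (by norm_num) (min_le_right _ _)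
  unfold bump
  set c := max (-1 / 2) (min s (1 / 2))
  rw [abs_le]
  constructor
  · refine le_min ?_ ?_
    · nlinarith
    · nlinarith
  · exact (min_le_right _ _).trans (by nlinarith)

theorem monotone_bump {p : ℝ} (hp : |p| ≤ 1 / 4) : Monotone (bump p) := by
  rw [abs_le] at hp
  have h₁ : 0 ≤ 3 / 4 / (1 / 2 - p) := div_nonneg (by norm_num) (by linarith)
  have h₂ : 0 ≤ 1 / 4 / (1 / 2 + p) := div_nonneg (by norm_num) (by linarith)
  intro x y h
  unfold bump
  gcongr

theorem bump_lt {p x y : ℝ} (hp : |p| ≤ 1 / 4) (hx : x < 1 / 2) (hy : -1 / 2 < y) (h : x < y) :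
    bump p x < bump p y := by
  rw [abs_le] at hp
  have h₁ : 0 < 3 / 4 / (1 / 2 - p) := div_pos (by norm_num) (by linarith)
  have h₂ : 0 < 1 / 4 / (1 / 2 + p) := div_pos (by norm_num) (by linarith)
  have hc : max (-1 / 2) (min x (1 / 2)) < max (-1 / 2) (min y (1 / 2)) := by
    rw [min_eq_left hx.le]
    refine max_lt ?_ ?_
    · exact lt_max_of_lt_right (lt_min hy (by norm_num))
    · exact lt_max_of_lt_right (lt_min h hx)
  unfold bump
  apply min_lt_min <;> gcongr

theorem bump_of_half_le {p s : ℝ} (hp : |p| ≤ 1 / 4) (hs : 1 / 2 ≤ s) : bump p s = 1 / 2 := by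
  rw [abs_le] at hp
  have h₁ : 1 ≤ 3 / 4 / (1 / 2 - p) := by rw [le_div_iff₀] <;> linarith
  unfold bump
  rw [min_eq_right hs, max_eq_right (by norm_num : (-1 / 2 : ℝ) ≤ 1 / 2), min_eq_right]
  · ring
  · linarith

theorem bump_of_le_neg_half {p s : ℝ} (hp : |p| ≤ 1 / 4) (hs : s ≤ -1 / 2) :
    bump p s = -1 / 2 := by
  rw [abs_le] at hp
  have h₁ : 1 / 4 / (1 / 2 + p) ≤ 1 := by rw [div_le_one] <;> linarith
  unfold bump
  rw [min_eq_left (by linarith : s ≤ 1 / 2), max_eq_left hs, min_eq_left]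
  · ring
  · linarith

theorem bump_of_abs_le {p s : ℝ} (hp : |p| ≤ 1 / 4) (hs : |s| ≤ 1 / 2) :
    bump p s = min (1 / 4 + 3 / 4 / (1 / 2 - p) * (s + p))
      (1 / 4 + 1 / 4 / (1 / 2 + p) * (s + p)) := by
  rw [abs_le] at hp hs
  have e₂ : (1 : ℝ) / 2 - p ≠ 0 := by linarith
  have e₃ : (1 : ℝ) / 2 + p ≠ 0 := by linarith
  unfold bump
  rw [min_eq_left hs.2, max_eq_right (by linarith)]
  congr 1
  · have : s + 1 / 2 = (s + p) + (1 / 2 - p) := by ring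
    rw [this, mul_add, div_mul_cancel₀ _ e₂]
    ring
  · have : s - 1 / 2 = (s + p) - (1 / 2 + p) := by ring
    rw [this, mul_sub, div_mul_cancel₀ _ e₃]
    ring

/-- Both summands are monotone, and at least one is strict: `bump` if the interval from `x` to `y`
meets `(-1/2, 1/2)`, otherwise `ramp`. -/
theorem strictMono_polyline {p t : ℝ} (hp : |p| ≤ 1 / 4) (ht : 0 < t) :
    StrictMono (polyline p t) := by
  intro x y h
  have hb : t * bump p x ≤ t * bump p y := mul_le_mul_of_nonneg_left (monotone_bump hp h.le) ht.le
  unfold polyline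
  rcases lt_or_ge x (1 / 2) with hx | hx
  · rcases lt_or_ge (-1 / 2) y with hy | hy
    · exact add_lt_add_of_lt_of_le (mul_lt_mul_of_pos_left (bump_lt hp hx hy h) ht)
        (monotone_ramp t h.le)
    · have := ramp_lt_of_half_le ht.le (by linarith : 1 / 2 ≤ -y) (neg_lt_neg h)
      rw [ramp_neg, ramp_neg] at this
      linarith
  · exact add_lt_add_of_le_of_lt hb (ramp_lt_of_half_le ht.le hx h)

theorem monotone_polyline {p t : ℝ} (hp : |p| ≤ 1 / 4) (ht : 0 ≤ t) :
    Monotone (polyline p t) := fun _ _ h =>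
  add_le_add (mul_le_mul_of_nonneg_left (monotone_bump hp h) ht) (monotone_ramp t h)

theorem continuous_polyline (p t : ℝ) : Continuous (polyline p t) := by
  unfold polyline bump ramp
  fun_prop

theorem polyline_of_half_le {p t s : ℝ} (hp : |p| ≤ 1 / 4) (hs : 1 / 2 ≤ s) (ht : 0 ≤ t) :
    polyline p t s = t / 2 + max (s - 1 / 2) (2 * s - 1 - t / 2) := by
  unfold polyline ramp
  rw [bump_of_half_le hp hs, max_eq_right (a := (0 : ℝ)) (le_max_of_le_left (by linarith)),
    max_eq_left (a := (0 : ℝ)) (max_le (by linarith) (by linarith))]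
  ring

theorem polyline_of_le_neg_half {p t s : ℝ} (hp : |p| ≤ 1 / 4) (hs : s ≤ -1 / 2) (ht : 0 ≤ t) :
    polyline p t s = -(t / 2) - max (-s - 1 / 2) (-2 * s - 1 - t / 2) := by
  unfold polyline ramp
  rw [bump_of_le_neg_half hp hs,
    max_eq_left (a := (0 : ℝ)) (b := max (s - 1 / 2) _) (max_le (by linarith) (by linarith)),
    max_eq_right (a := (0 : ℝ)) (le_max_of_le_left (by linarith))]
  ring

theorem surjective_polyline {p t : ℝ} (hp : |p| ≤ 1 / 4) (ht : 0 ≤ t) :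
    Function.Surjective (polyline p t) := by
  refine (continuous_polyline p t).surjective ?_ ?_
  · refine tendsto_atTop_mono' _ ?_ (tendsto_atTop_add_const_right _ (-(1 / 2) : ℝ) tendsto_id)
    filter_upwards [eventually_ge_atTop (1 / 2 : ℝ)] with s hs
    rw [polyline_of_half_le hp hs ht]
    have := le_max_left (s - 1 / 2) (2 * s - 1 - t / 2)
    simp only [id]
    linarith
  · refine tendsto_atBot_mono' _ ?_ (tendsto_atBot_add_const_right _ (1 / 2 : ℝ) tendsto_id)
    filter_upwards [eventually_le_atBot (-1 / 2 : ℝ)] with s hs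
    rw [polyline_of_le_neg_half hp hs ht]
    have := le_max_left (-s - 1 / 2) (-2 * s - 1 - t / 2)
    simp only [id]
    linarith

/-- The outermost segment lies on the line `y = 2 * s - 1` for every `t`. This independence of `t`
is why `Lam` fixes the horizontal sides of its square. -/
theorem polyline_outer {p t d : ℝ} (hp : |p| ≤ 1 / 4) (ht : 0 ≤ t) (htd : t ≤ d) :
    polyline p t ((1 + d) / 2) = d := by
  rw [polyline_of_half_le hp (by linarith) ht, max_eq_right (by linarith)]
  ring

theorem polyline_neg_outer {p t d : ℝ} (hp : |p| ≤ 1 / 4) (ht : 0 ≤ t) (htd : t ≤ d) :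
    polyline p t (-((1 + d) / 2)) = -d := by
  rw [polyline_of_le_neg_half hp (by linarith) ht, max_eq_right (by linarith)]
  ring

theorem polyline_half {p t : ℝ} (hp : |p| ≤ 1 / 4) (ht : 0 ≤ t) : polyline p t (1 / 2) = t / 2 := by
  rw [polyline_of_half_le hp le_rfl ht, max_eq_left (by linarith)]
  ring

theorem polyline_neg_half {p t : ℝ} (hp : |p| ≤ 1 / 4) (ht : 0 ≤ t) :
    polyline p t (-(1 / 2)) = -(t / 2) := by
  rw [polyline_of_le_neg_half hp (by norm_num) ht, max_eq_left (by linarith)]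
  ring

theorem polyline_zero (p s : ℝ) : polyline p 0 s = ramp 0 s := by simp [polyline]

theorem abs_le_half_of_ramp_eq_zero {s : ℝ} (h : ramp 0 s = 0) : |s| ≤ 1 / 2 := by
  have aux (u : ℝ) (hu : 1 / 2 < u) : 0 < ramp 0 u := by
    have half : ramp 0 (1 / 2) = 0 := ramp_eq_zero le_rfl (by norm_num [abs_of_pos])
    exact half.symm.trans_lt (ramp_lt_of_half_le le_rfl le_rfl hu)
  rw [abs_le]
  constructor
  · by_contra hs
    have := aux (-s) (by linarith)
    rw [ramp_neg, h] at this
    simp at this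
  · by_contra hs
    exact (aux s (by linarith)).ne' h

theorem ramp_zero_injective {x y : ℝ} (h : ramp 0 x = ramp 0 y) (h₀ : ramp 0 x ≠ 0) : x = y := by
  wlog hxy : x < y generalizing x y
  · rcases (not_lt.1 hxy).eq_or_lt with e | e
    · exact e.symm
    · exact (this h.symm (h ▸ h₀) e).symm
  exfalso
  rcases le_or_gt (1 / 2) x with hx | hx
  · exact (ramp_lt_of_half_le le_rfl hx hxy).ne h
  rcases le_or_gt y (-(1 / 2)) with hy | hy
  · have := ramp_lt_of_half_le le_rfl (by linarith : 1 / 2 ≤ -y) (neg_lt_neg hxy)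
    rw [ramp_neg, ramp_neg, h] at this
    exact lt_irrefl _ this
  have half : ramp 0 (1 / 2) = 0 := ramp_eq_zero le_rfl (by norm_num [abs_of_pos])
  have h₁ := monotone_ramp 0 hx.le
  have h₂ := monotone_ramp 0 hy.le
  rw [ramp_neg, half, neg_zero, ← h] at h₂
  rw [half] at h₁
  exact h₀ (le_antisymm h₁ h₂)

/-! ### Identification of `h^α_t` with the closed form, and joint continuity. -/

namespace Setup

variable (D : Setup) (α : ℕ → unitInterval)

/-- At `t = 0` the definition gives a default value: the level is the infimum of the empty set. It
obeys the same bound, so `t = 0` needs no separate treatment later. -/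
theorem abs_p_le_of_nonneg {t : ℝ} (h₀ : 0 ≤ t) (h₁ : t ≤ 1) : |D.p α t| ≤ 1 / 4 := by
  rcases h₀.eq_or_lt with rfl | h₀
  · have hl : D.level 0 = 0 := by
      have : {k : ℕ | D.ε (k + 1) < 0} = ∅ :=
        eq_empty_of_forall_notMem fun k hk => lt_asymm (D.ε_pos (k + 1)) hk
      rw [level, this, Nat.sInf_empty]
    have e : D.p α 0 = D.low α 0 := by
      unfold p
      simp only [hl]
      refine if_pos ?_
      have h₁ := D.c_lt 0 (show (0 : Fin 5) < 1 by decide)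
      rw [D.c_zero] at h₁
      exact ((D.ε_pos 1).trans h₁).le
    rw [e]
    exact D.abs_low_le α 0
  · exact D.abs_p_le α h₀ h₁

/-- Slopes decide between `min` and `max`. As `|p| ≤ 1/4`, the middle part of `bump` has slope at
least `1` before `-p` and at most `1` after it, hence is a minimum of two lines; outwards from
`±1/2` the slopes are `1`, then `2`, hence a maximum. For `t = 1` the outer segments degenerate. -/
theorem hpos_eq {t s : ℝ} (h₀ : 0 ≤ t) (h₁ : t < 1) :
    D.hpos α t s = polyline (D.p α t) t s := by
  have hp' := D.abs_p_le_of_nonneg α h₀ h₁.le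
  have hp := abs_le.1 hp'
  unfold hpos
  generalize D.p α t = p at *
  have e₁ : (1 : ℝ) - t ≠ 0 := by linarith
  have e₂ : (1 : ℝ) / 2 - p ≠ 0 := by linarith
  have e₃ : (1 : ℝ) / 2 + p ≠ 0 := by linarith
  have m₁ : 1 ≤ 3 / 4 / (1 / 2 - p) := by rw [le_div_iff₀] <;> linarith
  have m₂ : 1 / 4 / (1 / 2 + p) ≤ 1 := by rw [div_le_one] <;> linarith
  split_ifs with a₁ a₂ a₃ a₄ a₅
  · rw [polyline_of_le_neg_half hp' (by linarith) h₀, max_eq_right (by linarith)]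
    have : -(1 + t) / 2 - -1 = (1 - t) / 2 := by ring
    unfold seg
    rw [this]
    field_simp
    ring
  · rw [polyline_of_le_neg_half hp' a₂ h₀, max_eq_left (by linarith)]
    have ht : t ≠ 0 := by
      rintro rfl
      apply a₁
      linarith
    have : -1 / 2 - -(1 + t) / 2 = t / 2 := by ring
    unfold seg
    rw [this]
    field_simp
    ring
  · have hr : ramp t s = 0 := ramp_eq_zero h₀ (abs_le.2 ⟨by linarith, by linarith⟩)
    unfold polyline
    rw [hr]
    rw [bump_of_abs_le hp' (abs_le.2 ⟨by linarith, by linarith⟩), min_eq_left (by nlinarith)]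
    have h₁ : -p - -1 / 2 = 1 / 2 - p := by ring
    have h₂ : s - -1 / 2 = (s + p) + (1 / 2 - p) := by ring
    unfold seg
    rw [h₁, h₂, mul_add, div_mul_cancel₀ _ e₂]
    ring
  · have hr : ramp t s = 0 := ramp_eq_zero h₀ (abs_le.2 ⟨by linarith, by linarith⟩)
    unfold polyline
    rw [hr]
    rw [bump_of_abs_le hp' (abs_le.2 ⟨by linarith, by linarith⟩), min_eq_right (by nlinarith)]
    have : 1 / 2 - -p = 1 / 2 + p := by ring
    unfold seg
    rw [this]
    field_simp
    ring
  · rw [polyline_of_half_le hp' (by linarith) h₀, max_eq_left (by linarith)]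
    have ht : t ≠ 0 := by
      rintro rfl
      apply a₄
      linarith
    have : (1 + t) / 2 - 1 / 2 = t / 2 := by ring
    unfold seg
    rw [this]
    field_simp
    ring
  · rw [polyline_of_half_le hp' (by linarith) h₀, max_eq_right (by linarith)]
    have : 1 - (1 + t) / 2 = (1 - t) / 2 := by ring
    unfold seg
    rw [this]
    field_simp
    ring

theorem continuousAt_polyline {t s : ℝ} (ht : |t| < 1) :
    ContinuousAt (fun x : ℝ × ℝ => polyline (D.p α |x.1|) |x.1| x.2) (t, s) := by
  unfold polyline
  refine ContinuousAt.add ?_ ?_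
  · rcases eq_or_ne t 0 with rfl | h0
    -- `p_α` need not have a limit at `0`, but `bump` is bounded by `1/2`, so the factor `t` kills
    -- the oscillation.
    · have hz : Tendsto (fun x : ℝ × ℝ => |x.1| * (1 / 2)) (𝓝 (0, s)) (𝓝 0) := by
        have : Continuous fun x : ℝ × ℝ => |x.1| * (1 / 2) := by fun_prop
        simpa using this.tendsto (0, s)
      have : Tendsto (fun x : ℝ × ℝ => |x.1| * bump (D.p α |x.1|) x.2) (𝓝 (0, s)) (𝓝 0) := by
        refine squeeze_zero_norm' ?_ hz
        have hc : Continuous fun x : ℝ × ℝ => |x.1| := by fun_prop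
        filter_upwards [hc.continuousAt.eventually_lt continuousAt_const
          (show |((0 : ℝ), s).1| < 1 by simp)] with x hx
        rw [Real.norm_eq_abs, abs_mul, abs_abs]
        exact mul_le_mul_of_nonneg_left (abs_bump_le (D.abs_p_le_of_nonneg α (abs_nonneg _) hx.le))
          (abs_nonneg _)
      unfold ContinuousAt
      simpa using this
    · have hpt := D.continuousAt_p α (abs_pos.2 h0) ht
      have hp := abs_le.1 (D.abs_p_le α (abs_pos.2 h0) ht.le)
      have hpc : ContinuousAt (fun x : ℝ × ℝ => D.p α |x.1|) (t, s) :=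
        ContinuousAt.comp (g := D.p α) (f := fun x : ℝ × ℝ => |x.1|) hpt (by fun_prop)
      unfold bump
      have e₂ : (1 : ℝ) / 2 - D.p α |t| ≠ 0 := by linarith
      have e₃ : (1 : ℝ) / 2 + D.p α |t| ≠ 0 := by linarith
      fun_prop (disch := assumption)
  · have : Continuous fun x : ℝ × ℝ => ramp |x.1| x.2 :=
      continuous_ramp.comp ((continuous_abs.comp continuous_fst).prodMk continuous_snd)
    exact this.continuousAt

end Setup

/-! ### Real coordinates on the circle. -/

theorem coe_rep (x : UnitAddCircle) : ((rep x : ℝ) : UnitAddCircle) = x :=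
  (AddCircle.equivIco (1 : ℝ) (-1 / 2)).symm_apply_apply x

theorem rep_mem (x : UnitAddCircle) : rep x ∈ Ico (-1 / 2 : ℝ) (1 / 2) := by
  have := (AddCircle.equivIco (1 : ℝ) (-1 / 2) x).2
  exact ⟨this.1, this.2.trans_le (by norm_num)⟩

theorem norm_coe_of_abs_le {t : ℝ} (ht : |t| ≤ 1 / 2) : ‖(t : UnitAddCircle)‖ = |t| :=
  (AddCircle.norm_coe_eq_abs_iff 1 one_ne_zero).2 (by simpa using ht)

theorem norm_coe_le_abs (t : ℝ) : ‖(t : UnitAddCircle)‖ ≤ |t| := by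
  rw [UnitAddCircle.norm_eq]
  exact round_le t 0 |>.trans (by simp)

theorem abs_rep (x : UnitAddCircle) : |rep x| = ‖x‖ := by
  have h := rep_mem x
  conv_rhs => rw [← coe_rep x]
  exact (norm_coe_of_abs_le (abs_le.2 ⟨by linarith [h.1], h.2.le⟩)).symm

theorem rep_coe {t : ℝ} (ht : |t| < 1 / 2) : rep (t : UnitAddCircle) = t := by
  rw [abs_lt] at ht
  refine AddCircle.equivIco_coe_of_mem (p := (1 : ℝ)) (a := -1 / 2) ?_
  constructor <;> linarith

theorem coe_injOn {s t : ℝ} (hs : |s| < 1 / 2) (ht : |t| < 1 / 2)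
    (h : (s : UnitAddCircle) = t) : s = t := by
  rw [← rep_coe hs, h, rep_coe ht]

theorem continuousAt_rep {x : UnitAddCircle} (hx : ‖x‖ < 1 / 2) : ContinuousAt rep x := by
  refine continuous_subtype_val.continuousAt.comp (AddCircle.continuousAt_equivIco _ _ ?_)
  rintro rfl
  rw [norm_coe_of_abs_le (by norm_num [abs_of_neg])] at hx
  norm_num [abs_of_neg] at hx

/-! ### The maps `Lam` on a single square. -/

namespace Setup

variable (D : Setup) (α : ℕ → unitInterval)

theorem h_eq {t : ℝ} (ht : |t| < 1) (s : ℝ) : D.h α t s = polyline (D.p α |t|) |t| s :=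
  D.hpos_eq α (abs_nonneg t) ht

theorem abs_p_abs_le {t : ℝ} (ht : |t| < 1) : |D.p α (|t|)| ≤ 1 / 4 :=
  D.abs_p_le_of_nonneg α (abs_nonneg t) ht.le

variable {d : ℝ}

theorem strictMono_h {t : ℝ} (h₀ : t ≠ 0) (ht : |t| < 1) : StrictMono (D.h α t) := by
  have : D.h α t = polyline (D.p α |t|) |t| := funext (D.h_eq α ht)
  rw [this]
  exact strictMono_polyline (D.abs_p_abs_le α ht) (abs_pos.2 h₀)

theorem monotone_h {t : ℝ} (ht : |t| < 1) : Monotone (D.h α t) := by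
  have : D.h α t = polyline (D.p α |t|) |t| := funext (D.h_eq α ht)
  rw [this]
  exact monotone_polyline (D.abs_p_abs_le α ht) (abs_nonneg t)

theorem continuous_h {t : ℝ} (ht : |t| < 1) : Continuous (D.h α t) := by
  have : D.h α t = polyline (D.p α |t|) |t| := funext (D.h_eq α ht)
  rw [this]
  exact continuous_polyline _ _

theorem surjective_h {t : ℝ} (ht : |t| < 1) : Function.Surjective (D.h α t) := by
  have : D.h α t = polyline (D.p α |t|) |t| := funext (D.h_eq α ht)
  rw [this]
  exact surjective_polyline (D.abs_p_abs_le α ht) (abs_nonneg t)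

theorem h_outer {t : ℝ} (hd : d < 1) (ht : |t| ≤ d) : D.h α t ((1 + d) / 2) = d := by
  rw [D.h_eq α (ht.trans_lt hd)]
  exact polyline_outer (D.abs_p_abs_le α (ht.trans_lt hd)) (abs_nonneg t) ht

theorem h_neg_outer {t : ℝ} (hd : d < 1) (ht : |t| ≤ d) : D.h α t (-((1 + d) / 2)) = -d := by
  rw [D.h_eq α (ht.trans_lt hd)]
  exact polyline_neg_outer (D.abs_p_abs_le α (ht.trans_lt hd)) (abs_nonneg t) ht

theorem abs_h_le {t u : ℝ} (hd : d < 1) (ht : |t| ≤ d) (hu : |u| ≤ (1 + d) / 2) :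
    |D.h α t u| ≤ d := by
  rw [abs_le] at hu ⊢
  have hm := D.monotone_h α (ht.trans_lt hd)
  exact ⟨D.h_neg_outer α hd ht ▸ hm hu.1, (hm hu.2).trans_eq (D.h_outer α hd ht)⟩

theorem hinv_h (h₀ : 0 < d) (hd : d < 1) {u : ℝ} (hu : |u| ≤ (1 + d) / 2) :
    D.hinv α d (D.h α d u) = u := by
  have hd' : |d| < 1 := by rwa [abs_of_pos h₀]
  have hinj := (D.strictMono_h α h₀.ne' hd').injective
  rw [abs_le] at hu
  have hmem : u ∈ Icc (-1 : ℝ) 1 := ⟨by linarith, by linarith⟩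
  exact hinj (Function.invFunOn_eq ⟨u, hmem, rfl⟩)

theorem exists_h_eq {t s : ℝ} (hd : d < 1) (ht : |t| ≤ d) (hs : |s| ≤ d) :
    ∃ u, |u| ≤ (1 + d) / 2 ∧ D.h α t u = s := by
  have h₀ : 0 ≤ d := (abs_nonneg t).trans ht
  obtain ⟨u, hu, hus⟩ := intermediate_value_Icc (by linarith : -((1 + d) / 2) ≤ (1 + d) / 2)
    (D.continuous_h α (ht.trans_lt hd)).continuousOn (show s ∈ Icc _ _ by
      rw [D.h_outer α hd ht, D.h_neg_outer α hd ht]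
      exact abs_le.1 hs)
  exact ⟨u, abs_le.2 hu, hus⟩

theorem hinv_spec {s : ℝ} (h₀ : 0 < d) (hd : d < 1) (hs : |s| ≤ d) :
    |D.hinv α d s| ≤ (1 + d) / 2 ∧ D.h α d (D.hinv α d s) = s := by
  obtain ⟨u, hu, rfl⟩ := D.exists_h_eq α hd (abs_of_pos h₀).le hs
  rw [D.hinv_h α h₀ hd hu]
  exact ⟨hu, rfl⟩

theorem continuousOn_hinv (h₀ : 0 < d) (hd : d < 1) : ContinuousOn (D.hinv α d) (Icc (-d) d) := by
  have hd' : |d| < 1 := by rwa [abs_of_pos h₀]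
  let e := (D.strictMono_h α h₀.ne' hd').orderIsoOfSurjective _ (D.surjective_h α hd')
  refine e.symm.continuous.continuousOn.congr fun s hs => ?_
  rw [OrderIso.eq_symm_apply]
  exact (D.hinv_spec α h₀ hd (abs_le.2 hs)).2

/-- The fibre component of `Λ_{α,n}`, in coordinates centred at `z_n`. -/
noncomputable def slide (d t s : ℝ) : ℝ := D.h α t (D.hinv α d s)

theorem abs_slide_le (hd : d < 1) {t s : ℝ} (ht : |t| ≤ d) (hs : |s| ≤ d) (h₀ : 0 < d) :
    |D.slide α d t s| ≤ d :=
  D.abs_h_le α hd ht (D.hinv_spec α h₀ hd hs).1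

theorem slide_of_abs_left_eq (hd : d < 1) {t s : ℝ} (ht : |t| = d) (hs : |s| ≤ d) (h₀ : 0 < d) :
    D.slide α d t s = s := by
  have : D.h α t = D.h α d := by
    unfold h
    rw [ht, abs_of_pos h₀]
  rw [slide, this]
  exact (D.hinv_spec α h₀ hd hs).2

theorem slide_of_abs_right_eq (hd : d < 1) {t s : ℝ} (ht : |t| ≤ d) (hs : |s| = d) (h₀ : 0 < d) :
    D.slide α d t s = s := by
  have hd' := (abs_of_pos h₀).le
  have hu : |(1 + d) / 2| ≤ (1 + d) / 2 := (abs_of_pos (by linarith)).le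
  rcases abs_choice s with e | e
  · have e : s = d := by rw [← hs, e]
    have := D.hinv_h α h₀ hd hu
    rw [D.h_outer α hd hd'] at this
    rw [e, slide, this, D.h_outer α hd ht]
  · have e : s = -d := by rw [← hs, e, neg_neg]
    have := D.hinv_h α h₀ hd (u := -((1 + d) / 2)) (by rwa [abs_neg])
    rw [D.h_neg_outer α hd hd'] at this
    rw [e, slide, this, D.h_neg_outer α hd ht]

theorem exists_slide_eq (hd : d < 1) {t s : ℝ} (ht : |t| ≤ d) (hs : |s| ≤ d) (h₀ : 0 < d) :
    ∃ r, |r| ≤ d ∧ D.slide α d t r = s := by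
  obtain ⟨u, hu, rfl⟩ := D.exists_h_eq α hd ht hs
  have hd' := (abs_of_pos h₀).le
  exact ⟨D.h α d u, D.abs_h_le α hd hd' hu, by rw [slide, D.hinv_h α h₀ hd hu]⟩

/-- For `t ≠ 0` the polyline is strictly increasing; for `t = 0` it is `ramp 0`, which is injective
away from its zero set. -/
theorem slide_inj (hd : d < 1) {t s s' : ℝ} (ht : |t| ≤ d) (hs : |s| ≤ d) (hs' : |s'| ≤ d)
    (h₀ : 0 < d) (h : D.slide α d t s = D.slide α d t s') :
    s = s' ∨ t = 0 ∧ D.slide α d t s = 0 := by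
  by_contra! hne
  refine hne.1 ?_
  have hinv : D.hinv α d s = D.hinv α d s' := by
    rcases eq_or_ne t 0 with rfl | h0
    · have h1 := hne.2 rfl
      unfold slide at h h1
      simp only [D.h_eq α (show |(0 : ℝ)| < 1 by simp), abs_zero, polyline_zero] at h h1
      exact ramp_zero_injective h h1
    · exact (D.strictMono_h α h0 (ht.trans_lt hd)).injective h
  rw [← (D.hinv_spec α h₀ hd hs).2, hinv, (D.hinv_spec α h₀ hd hs').2]

theorem h_half {t : ℝ} (ht : |t| < 1) : D.h α t (1 / 2) = |t| / 2 := by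
  rw [D.h_eq α ht, polyline_half (D.abs_p_abs_le α ht) (abs_nonneg t)]

theorem h_neg_half {t : ℝ} (ht : |t| < 1) : D.h α t (-(1 / 2)) = -(|t| / 2) := by
  rw [D.h_eq α ht, polyline_neg_half (D.abs_p_abs_le α ht) (abs_nonneg t)]

/-- `h_0` vanishes only on `[-1/2, 1/2]`, which `h_d` maps onto `[-d/2, d/2]`. The collapsed segment
thus has length at most `d`, as the fibre condition requires. -/
theorem abs_le_of_slide_zero (hd : d < 1) {s : ℝ} (hs : |s| ≤ d) (h₀ : 0 < d)
    (h : D.slide α d 0 s = 0) : |s| ≤ d / 2 := by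
  have hd' : |d| < 1 := by rwa [abs_of_pos h₀]
  unfold slide at h
  rw [D.h_eq α (show |(0 : ℝ)| < 1 by simp), abs_zero, polyline_zero] at h
  have hu := abs_le.1 (abs_le_half_of_ramp_eq_zero h)
  have hm := D.monotone_h α hd'
  have h₁ := hm hu.1
  have h₂ := hm hu.2
  rw [D.h_half α hd', (D.hinv_spec α h₀ hd hs).2, abs_of_pos h₀] at h₂
  rw [D.h_neg_half α hd', (D.hinv_spec α h₀ hd hs).2, abs_of_pos h₀] at h₁
  exact abs_le.2 ⟨h₁, h₂⟩

theorem slide_zero_half (hd : d < 1) (h₀ : 0 < d) : D.slide α d 0 (d / 2) = 0 := by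
  have hd' : |d| < 1 := by rwa [abs_of_pos h₀]
  have e : D.h α d (1 / 2) = d / 2 := by rw [D.h_half α hd', abs_of_pos h₀]
  have hu : |(1 / 2 : ℝ)| ≤ (1 + d) / 2 := by
    rw [abs_of_pos] <;> linarith
  rw [slide, ← e, D.hinv_h α h₀ hd hu, D.h_half α (by simp), abs_zero, zero_div]

theorem slide_zero_neg_half (hd : d < 1) (h₀ : 0 < d) : D.slide α d 0 (-(d / 2)) = 0 := by
  have hd' : |d| < 1 := by rwa [abs_of_pos h₀]
  have e : D.h α d (-(1 / 2)) = -(d / 2) := by rw [D.h_neg_half α hd', abs_of_pos h₀]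
  have hu : |(-(1 / 2) : ℝ)| ≤ (1 + d) / 2 := by
    rw [abs_neg, abs_of_pos] <;> linarith
  rw [slide, ← e, D.hinv_h α h₀ hd hu, D.h_neg_half α (by simp), abs_zero, zero_div, neg_zero]

theorem continuousOn_slide (hd : d < 1) (h₀ : 0 < d) :
    ContinuousOn (fun x : ℝ × ℝ => D.slide α d x.1 x.2) (Icc (-d) d ×ˢ Icc (-d) d) := by
  have h₁ : ContinuousOn (fun x : ℝ × ℝ => (x.1, D.hinv α d x.2)) (Icc (-d) d ×ˢ Icc (-d) d) :=
    continuousOn_fst.prodMk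
      ((D.continuousOn_hinv α h₀ hd).comp continuousOn_snd fun x hx => hx.2)
  have h₂ : ContinuousOn (fun x : ℝ × ℝ => polyline (D.p α |x.1|) |x.1| x.2) {x | |x.1| < 1} :=
    fun x hx => (D.continuousAt_polyline α hx).continuousWithinAt
  refine (h₂.comp h₁ fun x hx => (abs_le.2 hx.1).trans_lt hd).congr fun x hx => ?_
  exact D.h_eq α ((abs_le.2 hx.1).trans_lt hd) _

theorem mem_A_iff {n : ℕ} {w : Torus} :
    w ∈ D.A d n ↔ ‖w.1 - (D.z n).1‖ ≤ d ∧ ‖w.2 - (D.z n).2‖ ≤ d := by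
  constructor
  · rintro ⟨t, s, ht, hs, rfl⟩
    simp only [Prod.fst_add, Prod.snd_add, add_sub_cancel_left]
    exact ⟨(norm_coe_le_abs t).trans ht, (norm_coe_le_abs s).trans hs⟩
  · rintro ⟨h₁, h₂⟩
    refine ⟨_, _, (abs_rep _).trans_le h₁, (abs_rep _).trans_le h₂, ?_⟩
    rw [coe_rep, coe_rep]
    ext <;> simp

theorem mem_A_iff_dist_le {n : ℕ} {w : Torus} : w ∈ D.A d n ↔ dist w (D.z n) ≤ d := by
  rw [D.mem_A_iff, Prod.dist_eq, dist_eq_norm, dist_eq_norm, max_le_iff]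

theorem Lam_of_notMem {n : ℕ} {w : Torus} (h : w ∉ D.A d n) : D.Lam α d n w = w := if_neg h

theorem Lam_of_mem {n : ℕ} {w : Torus} (h : w ∈ D.A d n) : D.Lam α d n w =
    (w.1, (D.z n).2 + ((D.slide α d (rep (w.1 - (D.z n).1)) (rep (w.2 - (D.z n).2)) : ℝ) :
      UnitAddCircle)) := if_pos h

theorem Lam_fst (n : ℕ) (w : Torus) : (D.Lam α d n w).1 = w.1 := by
  by_cases h : w ∈ D.A d n
  · rw [D.Lam_of_mem α h]
  · rw [D.Lam_of_notMem α h]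

theorem Lam_add (hd : d < 1 / 2) {n : ℕ} {t s : ℝ} (ht : |t| ≤ d) (hs : |s| ≤ d) :
    D.Lam α d n (D.z n + ((t : UnitAddCircle), (s : UnitAddCircle))) =
      D.z n + ((t : UnitAddCircle), (D.slide α d t s : UnitAddCircle)) := by
  rw [D.Lam_of_mem α ⟨t, s, ht, hs, rfl⟩]
  simp only [Prod.fst_add, Prod.snd_add, add_sub_cancel_left]
  rw [rep_coe (ht.trans_lt hd), rep_coe (hs.trans_lt hd)]
  rfl

theorem Lam_mem (h₀ : 0 < d) (hd : d < 1 / 2) {n : ℕ} {w : Torus} (h : w ∈ D.A d n) :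
    D.Lam α d n w ∈ D.A d n := by
  obtain ⟨t, s, ht, hs, rfl⟩ := h
  rw [D.Lam_add α hd ht hs]
  exact ⟨t, _, ht, D.abs_slide_le α (by linarith) ht hs h₀, rfl⟩

theorem Lam_mem_iff (h₀ : 0 < d) (hd : d < 1 / 2) {n : ℕ} {w : Torus} :
    D.Lam α d n w ∈ D.A d n ↔ w ∈ D.A d n := by
  refine ⟨fun h => ?_, D.Lam_mem α h₀ hd⟩
  by_contra hw
  rw [D.Lam_of_notMem α hw] at h
  exact hw h

theorem dist_Lam_le (h₀ : 0 < d) (hd : d < 1 / 2) (n : ℕ) (w : Torus) :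
    dist (D.Lam α d n w) w ≤ 2 * d := by
  by_cases h : w ∈ D.A d n
  · have h₁ := D.mem_A_iff_dist_le.1 (D.Lam_mem α h₀ hd h)
    have h₂ := D.mem_A_iff_dist_le.1 h
    linarith [dist_triangle_right (D.Lam α d n w) w (D.z n)]
  · rw [D.Lam_of_notMem α h, dist_self]
    linarith

/-- Gluing along the boundary of the square: `h_t = h_d` on the vertical sides, and the outer
vertices are common to all `h_t` on the horizontal ones. -/
theorem continuous_Lam (h₀ : 0 < d) (hd : d < 1 / 2) (n : ℕ) : Continuous (D.Lam α d n) := by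
  have hd₁ : d < 1 := by linarith
  have hc : Continuous fun w : Torus => dist w (D.z n) := by fun_prop
  have hA : IsClosed (D.A d n) := by
    have : D.A d n = {w | dist w (D.z n) ≤ d} := Set.ext fun w => D.mem_A_iff_dist_le
    rw [this]
    exact isClosed_le hc continuous_const
  have hB : IsClosed {w : Torus | d ≤ dist w (D.z n)} := isClosed_le continuous_const hc
  have hU : D.A d n ∪ {w : Torus | d ≤ dist w (D.z n)} = univ :=
    eq_univ_of_forall fun w => (le_total (dist w (D.z n)) d).imp D.mem_A_iff_dist_le.2 id
  rw [← continuousOn_univ, ← hU]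
  refine ContinuousOn.union_of_isClosed ?_ ?_ hA hB
  · refine ContinuousOn.congr ?_ fun w hw => D.Lam_of_mem α hw
    refine continuousOn_fst.prodMk (continuousOn_const.add ?_)
    refine (AddCircle.continuous_mk' (1 : ℝ)).comp_continuousOn ?_
    refine (D.continuousOn_slide α hd₁ h₀).comp (f := fun w : Torus =>
      (rep (w.1 - (D.z n).1), rep (w.2 - (D.z n).2))) ?_ ?_
    · intro w hw
      rw [D.mem_A_iff] at hw
      refine ContinuousAt.continuousWithinAt (ContinuousAt.prodMk ?_ ?_)
      · exact ContinuousAt.comp (g := rep) (f := fun w : Torus => w.1 - (D.z n).1)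
          (continuousAt_rep (hw.1.trans_lt hd)) (by fun_prop)
      · exact ContinuousAt.comp (g := rep) (f := fun w : Torus => w.2 - (D.z n).2)
          (continuousAt_rep (hw.2.trans_lt hd)) (by fun_prop)
    · intro w hw
      rw [D.mem_A_iff, ← abs_rep, ← abs_rep, abs_le, abs_le] at hw
      exact hw
  · refine continuousOn_id.congr fun w hw => ?_
    by_cases h : w ∈ D.A d n
    · have he : dist w (D.z n) = d := le_antisymm (D.mem_A_iff_dist_le.1 h) hw
      rw [D.Lam_of_mem α h]
      rw [D.mem_A_iff, ← abs_rep, ← abs_rep] at h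
      rw [Prod.dist_eq, dist_eq_norm, dist_eq_norm, ← abs_rep, ← abs_rep] at he
      have hs : D.slide α d (rep (w.1 - (D.z n).1)) (rep (w.2 - (D.z n).2)) =
          rep (w.2 - (D.z n).2) := by
        rcases max_choice |rep (w.1 - (D.z n).1)| |rep (w.2 - (D.z n).2)| with e | e
        · exact D.slide_of_abs_left_eq α hd₁ (e ▸ he) h.2 h₀
        · exact D.slide_of_abs_right_eq α hd₁ h.1 (e ▸ he) h₀
      rw [hs, coe_rep, add_sub_cancel]
      rfl
    · exact D.Lam_of_notMem α h

theorem surjective_Lam (h₀ : 0 < d) (hd : d < 1 / 2) (n : ℕ) :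
    Function.Surjective (D.Lam α d n) := by
  intro w
  by_cases h : w ∈ D.A d n
  · obtain ⟨t, s, ht, hs, rfl⟩ := h
    obtain ⟨r, hr, rfl⟩ := D.exists_slide_eq α (by linarith) ht hs h₀
    exact ⟨_, D.Lam_add α hd ht hr⟩
  · exact ⟨w, D.Lam_of_notMem α h⟩

theorem Lam_inj (h₀ : 0 < d) (hd : d < 1 / 2) {n : ℕ} {u v : Torus}
    (h : D.Lam α d n u = D.Lam α d n v) : u = v ∨ D.Lam α d n u = D.z n := by
  by_cases hu : u ∈ D.A d n
  · have hv : v ∈ D.A d n := by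
      rw [← D.Lam_mem_iff α h₀ hd, ← h]
      exact D.Lam_mem α h₀ hd hu
    obtain ⟨t, s, ht, hs, rfl⟩ := hu
    obtain ⟨t', s', ht', hs', rfl⟩ := hv
    have hd₁ : d < 1 := by linarith
    rw [D.Lam_add α hd ht hs] at h ⊢
    rw [D.Lam_add α hd ht' hs', add_right_inj, Prod.mk.injEq] at h
    obtain rfl := coe_injOn (ht.trans_lt hd) (ht'.trans_lt hd) h.1
    have e := coe_injOn ((D.abs_slide_le α hd₁ ht hs h₀).trans_lt hd)
      ((D.abs_slide_le α hd₁ ht hs' h₀).trans_lt hd) h.2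
    rcases D.slide_inj α hd₁ ht hs hs' h₀ e with rfl | ⟨rfl, e'⟩
    · exact Or.inl rfl
    · right
      rw [e', AddCircle.coe_zero, Prod.mk_zero_zero, add_zero]
  · have hv : v ∉ D.A d n := by
      rw [← D.Lam_mem_iff α h₀ hd, ← h, D.Lam_mem_iff α h₀ hd]
      exact hu
    rw [D.Lam_of_notMem α hu, D.Lam_of_notMem α hv] at h
    exact Or.inl h

theorem dist_le_of_Lam_eq (h₀ : 0 < d) (hd : d < 1 / 2) {n : ℕ} {w : Torus}
    (h : D.Lam α d n w = D.z n) : dist w (D.z n) ≤ d / 2 := by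
  have hw : w ∈ D.A d n := by
    rw [← D.Lam_mem_iff α h₀ hd, h, D.mem_A_iff_dist_le, dist_self]
    exact h₀.le
  obtain ⟨t, s, ht, hs, rfl⟩ := hw
  have hd₁ : d < 1 := by linarith
  rw [D.Lam_add α hd ht hs, add_eq_left, Prod.mk_eq_zero] at h
  have h00 : |(0 : ℝ)| < 1 / 2 := by norm_num
  obtain rfl := coe_injOn (ht.trans_lt hd) h00 h.1
  have e := coe_injOn ((D.abs_slide_le α hd₁ ht hs h₀).trans_lt hd) h00 h.2
  rw [dist_self_add_left, Prod.norm_def, max_le_iff]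
  refine ⟨by simp only [AddCircle.coe_zero, norm_zero]; linarith, (norm_coe_le_abs s).trans (D.abs_le_of_slide_zero α hd₁ hs h₀ e)⟩

theorem exists_ne_Lam_eq (h₀ : 0 < d) (hd : d < 1 / 2) (n : ℕ) :
    ∃ u v, u ≠ v ∧ D.Lam α d n u = D.z n ∧ D.Lam α d n v = D.z n := by
  have hd₁ : d < 1 := by linarith
  have h₁ : |d / 2| < d := by rw [abs_of_pos] <;> linarith
  have h₂ : |-(d / 2)| < d := by rwa [abs_neg]
  have h₃ : |(0 : ℝ)| ≤ d := by simpa using h₀.le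
  refine ⟨_, _, ?_, (D.Lam_add α hd h₃ h₁.le).trans ?_, (D.Lam_add α hd h₃ h₂.le).trans ?_⟩
  · intro h
    rw [add_right_inj, Prod.mk.injEq] at h
    have := coe_injOn (h₁.trans hd) (h₂.trans hd) h.2
    linarith
  · rw [D.slide_zero_half α hd₁ h₀, AddCircle.coe_zero, Prod.mk_zero_zero, add_zero]
  · rw [D.slide_zero_neg_half α hd₁ h₀, AddCircle.coe_zero, Prod.mk_zero_zero, add_zero]

theorem Lam_comm {d' : ℝ} (h₀ : 0 < d) (hd : d < 1 / 2) (h₀' : 0 < d') (hd' : d' < 1 / 2)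
    {m n : ℕ} (h : Disjoint (D.A d m) (D.A d' n)) :
    D.Lam α d m ∘ D.Lam α d' n = D.Lam α d' n ∘ D.Lam α d m := by
  funext w
  simp only [Function.comp_apply]
  by_cases h₁ : w ∈ D.A d m
  · have h₂ := disjoint_left.1 h h₁
    have h₃ := disjoint_left.1 h (D.Lam_mem α h₀ hd h₁)
    rw [D.Lam_of_notMem α h₂, D.Lam_of_notMem α h₃]
  · rw [D.Lam_of_notMem α h₁, D.Lam_of_notMem α]
    by_cases h₂ : w ∈ D.A d' n
    · exact disjoint_right.1 h (D.Lam_mem α h₀' hd' h₂)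
    · rwa [D.Lam_of_notMem α h₂]

end Setup

/-! ### The two metrics, the orbit and the dense set `X`. -/

theorem dist_le_tdist (u v : Torus) : dist u v ≤ tdist u v := by
  rw [Prod.dist_eq]
  refine max_le ?_ ?_ <;> refine Real.le_sqrt_of_sq_le ?_
  · linarith [sq_nonneg (dist u.2 v.2)]
  · linarith [sq_nonneg (dist u.1 v.1)]

theorem tdist_of_fst_eq {u v : Torus} (h : u.1 = v.1) : tdist u v = dist u.2 v.2 := by
  rw [tdist, h, dist_self, zero_pow two_ne_zero, zero_add, Real.sqrt_sq dist_nonneg]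

theorem tendsto_tdist {f g : ℕ → Torus} {a b : Torus} (hf : Tendsto f atTop (𝓝 a))
    (hg : Tendsto g atTop (𝓝 b)) :
    Tendsto (fun n => tdist (f n) (g n)) atTop (𝓝 (tdist a b)) :=
  (((hf.fst_nhds.dist hg.fst_nhds).pow 2).add ((hf.snd_nhds.dist hg.snd_nhds).pow 2)).sqrt

theorem sigma_values (k : ℕ) : sigma (2 * k) = 2 * k + 2 ∧ sigma (2 * k + 3) = 2 * k + 1 := by
  constructor
  · exact if_pos (by omega)
  · unfold sigma
    rw [if_neg (by omega), if_neg (by omega)]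
    omega

theorem tau_values (k : ℕ) : tau (2 * k + 1) = 2 * k + 3 ∧ tau (2 * k + 2) = 2 * k := by
  constructor
  · exact if_pos (by omega)
  · unfold tau
    rw [if_neg (by omega), if_neg (by omega)]
    omega

theorem dense_compl_column (x : UnitAddCircle) : Dense {w : Torus | w.1 ≠ x} := by
  have : Nontrivial UnitAddCircle := by
    refine ⟨(0 : ℝ), (1 / 4 : ℝ), fun h => ?_⟩
    have := coe_injOn (by norm_num) (by norm_num [abs_of_pos]) h
    norm_num at this
  exact (dense_compl_singleton x).preimage isOpenMap_fst

namespace Setup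

variable (D : Setup)

theorem z_even (k : ℕ) : D.z (2 * k) = D.z₀ + k • D.v := by
  rw [z, if_pos (by omega), Nat.mul_div_cancel_left _ two_pos]

theorem z_odd (k : ℕ) : D.z (2 * k + 1) = D.z₀ - (k + 1) • D.v := by
  rw [z, if_neg (by omega)]
  congr 3
  omega

theorem T_z (n : ℕ) : D.T (D.z n) = D.z (sigma n) := by
  obtain ⟨k, rfl | rfl⟩ := Nat.even_or_odd' n
  · rw [(sigma_values k).1, show 2 * k + 2 = 2 * (k + 1) by ring, z_even, z_even, T, add_assoc,
      succ_nsmul]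
  · rcases k with _ | k
    · rw [T, z_odd, show sigma (2 * 0 + 1) = 2 * 0 from rfl, z_even]
      simp
    · rw [show 2 * (k + 1) + 1 = 2 * k + 3 by ring, (sigma_values k).2,
        show 2 * k + 3 = 2 * (k + 1) + 1 by ring, z_odd, z_odd, T, succ_nsmul _ (k + 1)]
      abel

theorem Tinv_z (n : ℕ) : D.Tinv (D.z n) = D.z (tau n) := by
  obtain ⟨k, rfl | rfl⟩ := Nat.even_or_odd' n
  · rcases k with _ | k
    · rw [Tinv, show tau (2 * 0) = 2 * 0 + 1 from rfl, z_odd, z_even]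
      simp
    · rw [show 2 * (k + 1) = 2 * k + 2 by ring, (tau_values k).2,
        show 2 * k + 2 = 2 * (k + 1) by ring, z_even, z_even, Tinv, succ_nsmul]
      abel
  · rw [(tau_values k).1, show 2 * k + 3 = 2 * (k + 1) + 1 by ring, z_odd, z_odd, Tinv,
      succ_nsmul _ (k + 1)]
    abel

theorem T_Tinv (w : Torus) : D.T (D.Tinv w) = w := sub_add_cancel _ _

theorem Tinv_T (w : Torus) : D.Tinv (D.T w) = w := add_sub_cancel_right _ _

theorem continuous_T : Continuous D.T := by
  unfold T
  fun_prop

theorem continuous_Tinv : Continuous D.Tinv := by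
  unfold Tinv
  fun_prop

theorem T_mem_X {w : Torus} (hw : w ∈ D.X) : D.T w ∈ D.X := by
  intro n h
  have h₁ : (D.Tinv (D.T w)).1 = (D.Tinv (D.z n)).1 := congrArg (· - D.v.1) h
  rw [Tinv_T, Tinv_z] at h₁
  exact hw _ h₁

theorem Tinv_mem_X {w : Torus} (hw : w ∈ D.X) : D.Tinv w ∈ D.X := by
  intro n h
  have h₁ : (D.T (D.Tinv w)).1 = (D.T (D.z n)).1 := congrArg (· + D.v.1) h
  rw [T_Tinv, T_z] at h₁
  exact hw _ h₁

theorem mem_X_iff_of_fst_eq {u w : Torus} (h : u.1 = w.1) : u ∈ D.X ↔ w ∈ D.X := by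
  simp only [X, mem_ofPred_eq, h]

theorem dense_X : Dense D.X := by
  have e : D.X = ⋂ n, {w : Torus | w.1 ≠ (D.z n).1} := by
    ext w
    simp [X]
  rw [e]
  exact dense_iInter_of_isOpen_nat (fun n => isOpen_ne_fun continuous_fst continuous_const)
    fun n => dense_compl_column _

/-- The dynamically relevant properties of the maps `Φ_α`: a continuous self-map of the torus
which preserves the vertical circles, collapses small sets to the points `z_n` and is injective
elsewhere. -/
structure Blowup (Φ : Torus → Torus) : Prop where
  continuous : Continuous Φ
  fst : ∀ w, (Φ w).1 = w.1
  inj : ∀ u v, Φ u = Φ v → u = v ∨ ∃ n, Φ u = D.z n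
  small : ∀ ε > 0, ∃ N, ∀ n ≥ N, ∀ u v, Φ u = D.z n → Φ v = D.z n → dist u v < ε
  nontrivial : ∃ u v, u ≠ v ∧ Φ u = D.z 0 ∧ Φ v = D.z 0

/-! ### The compositions `Φ_n` and their limit. -/

variable {D} {α : ℕ → unitInterval} {δ : ℕ → ℝ}

theorem PhiAlong_succ (e : ℕ → ℕ) (n : ℕ) : D.PhiAlong α δ e (n + 1) =
    D.Lam α (δ (e (n + 1))) (e (n + 1)) ∘ D.PhiAlong α δ e n := rfl

theorem PhiN_succ (n : ℕ) : D.PhiN α δ (n + 1) =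
    D.Lam α (δ (n + 1)) (n + 1) ∘ D.PhiN α δ n := rfl

theorem PhiAlong_fst (e : ℕ → ℕ) (n : ℕ) (w : Torus) : (D.PhiAlong α δ e n w).1 = w.1 := by
  induction n with
  | zero => exact D.Lam_fst α _ _
  | succ n ih => rw [PhiAlong_succ, Function.comp_apply, Lam_fst, ih]

theorem PhiN_fst (n : ℕ) (w : Torus) : (D.PhiN α δ n w).1 = w.1 := PhiAlong_fst id n w

namespace Admissible

variable (hA : D.Admissible α δ)
include hA

/-- The bound by powers of `2` gives only `δ 0 < 1`. But a square of half side at least `1/2` is the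
whole torus and could not be disjoint from the next one. -/
theorem lt_half (n : ℕ) : δ n < 1 / 2 := by
  by_contra! h
  have hz : D.z (n + 1) ∈ D.A (δ (n + 1)) (n + 1) := by
    rw [D.mem_A_iff_dist_le, dist_self]
    exact (hA.pos _).le
  have hle (x : UnitAddCircle) : ‖x‖ ≤ δ n := by
    have := rep_mem x
    rw [← abs_rep, abs_le]
    constructor <;> linarith [this.1, this.2]
  exact disjoint_right.1 (hA.disjoint n (n + 1) (by omega) (by omega)) hz
    (D.mem_A_iff.2 ⟨hle _, hle _⟩)

theorem z_fst_ne {m n : ℕ} (h : m ≠ n) : (D.z m).1 ≠ (D.z n).1 := by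
  wlog hmn : m < n generalizing m n
  · exact (this h.symm (by omega)).symm
  intro e
  have := hA.lt_dist m n hmn
  rw [e, dist_self, zero_div] at this
  exact lt_asymm this (hA.pos n)

theorem continuous_PhiAlong (e : ℕ → ℕ) (n : ℕ) : Continuous (D.PhiAlong α δ e n) := by
  induction n with
  | zero => exact D.continuous_Lam α (hA.pos _) (hA.lt_half _) _
  | succ n ih => exact (D.continuous_Lam α (hA.pos _) (hA.lt_half _) _).comp ih

theorem surjective_PhiAlong (e : ℕ → ℕ) (n : ℕ) : Function.Surjective (D.PhiAlong α δ e n) := by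
  induction n with
  | zero => exact D.surjective_Lam α (hA.pos _) (hA.lt_half _) _
  | succ n ih => exact (D.surjective_Lam α (hA.pos _) (hA.lt_half _) _).comp ih

theorem PhiN_inj (n : ℕ) {u v : Torus} (h : D.PhiN α δ n u = D.PhiN α δ n v) :
    u = v ∨ ∃ m ≤ n, u.1 = (D.z m).1 := by
  induction n with
  | zero =>
    refine (D.Lam_inj α (hA.pos _) (hA.lt_half _) h).imp id fun e => ⟨0, le_rfl, ?_⟩
    exact (D.Lam_fst α _ _).symm.trans (congrArg Prod.fst e)
  | succ n ih =>
    rcases D.Lam_inj α (hA.pos _) (hA.lt_half _) h with e | e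
    · exact (ih e).imp id fun ⟨m, hm, e'⟩ => ⟨m, by omega, e'⟩
    · refine Or.inr ⟨n + 1, le_rfl, ?_⟩
      exact (PhiN_fst (n + 1) u).symm.trans (congrArg Prod.fst e)

theorem PhiAlong_invFunOn (e : ℕ → ℕ) (n : ℕ) {y : Torus} (hy : y ∈ D.X) :
    D.PhiAlong α δ e n (Function.invFunOn (D.PhiAlong α δ e n) D.X y) = y := by
  obtain ⟨u, rfl⟩ := hA.surjective_PhiAlong e n y
  exact Function.invFunOn_eq ⟨u, (D.mem_X_iff_of_fst_eq (PhiAlong_fst e n u)).1 hy, rfl⟩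

theorem dist_PhiN_succ_le (n : ℕ) (w : Torus) :
    dist (D.PhiN α δ n w) (D.PhiN α δ (n + 1) w) ≤ 2 / 2 / 2 ^ n := by
  rw [dist_comm]
  refine (D.dist_Lam_le α (hA.pos _) (hA.lt_half _) (n + 1) _).trans ?_
  have := (hA.lt_pow (n + 1)).le
  rw [pow_succ] at this
  refine (mul_le_mul_of_nonneg_left this two_pos.le).trans_eq ?_
  field_simp

theorem tendsto_PhiN (w : Torus) :
    Tendsto (fun n => D.PhiN α δ n w) atTop (𝓝 (D.Phi α δ w)) :=
  (cauchySeq_of_le_geometric_two fun n => hA.dist_PhiN_succ_le n w).tendsto_limUnder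

theorem dist_PhiN_Phi_le (n : ℕ) (w : Torus) :
    dist (D.PhiN α δ n w) (D.Phi α δ w) ≤ 2 / 2 ^ n :=
  dist_le_of_le_geometric_two_of_tendsto (fun n => hA.dist_PhiN_succ_le n w) (hA.tendsto_PhiN w) n

omit hA in
theorem tendsto_two_div_pow : Tendsto (fun n : ℕ => (2 : ℝ) / 2 ^ n) atTop (𝓝 0) := by
  have := (tendsto_pow_atTop_nhds_zero_of_lt_one (r := (1 / 2 : ℝ)) (by norm_num)
    (by norm_num)).const_mul 2
  simpa [div_eq_mul_inv] using this

theorem continuous_Phi : Continuous (D.Phi α δ) := by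
  have h : TendstoUniformly (D.PhiN α δ) (D.Phi α δ) atTop := by
    rw [Metric.tendstoUniformly_iff]
    intro ε hε
    filter_upwards [tendsto_two_div_pow.eventually (gt_mem_nhds hε)] with n hn w
    rw [dist_comm]
    exact (hA.dist_PhiN_Phi_le n w).trans_lt hn
  exact h.continuous (Frequently.of_forall fun n => hA.continuous_PhiAlong id n)

theorem Phi_fst (w : Torus) : (D.Phi α δ w).1 = w.1 := by
  refine tendsto_nhds_unique (continuous_fst.continuousAt.tendsto.comp (hA.tendsto_PhiN w)) ?_
  simp only [Function.comp_def, PhiN_fst]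
  exact tendsto_const_nhds

/-- The range is compact, and it is dense because `Phi` is uniformly close to the surjections `Φ_n`.
-/
theorem surjective_Phi : Function.Surjective (D.Phi α δ) := by
  rw [← range_eq_univ, eq_univ_iff_forall]
  intro y
  have hc : IsClosed (range (D.Phi α δ)) := (isCompact_range hA.continuous_Phi).isClosed
  rw [← hc.closure_eq, Metric.mem_closure_iff]
  intro ε hε
  obtain ⟨n, hn⟩ := (tendsto_two_div_pow.eventually (gt_mem_nhds hε)).exists
  obtain ⟨w, rfl⟩ := hA.surjective_PhiAlong id n y
  exact ⟨_, mem_range_self w, (hA.dist_PhiN_Phi_le n w).trans_lt hn⟩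

theorem Phi_eq_PhiN {n : ℕ} {u : Torus} (hu : u.1 = (D.z n).1) :
    D.Phi α δ u = D.PhiN α δ n u := by
  refine tendsto_nhds_unique (hA.tendsto_PhiN u) (tendsto_atTop_of_eventually_const (i₀ := n) ?_)
  intro m hm
  induction m, hm using Nat.le_induction with
  | base => rfl
  | succ m hm ih =>
    rw [PhiN_succ, Function.comp_apply, ih]
    refine D.Lam_of_notMem α fun h => ?_
    exact disjoint_right.1 (hA.column n (m + 1) (by omega)) h ((PhiN_fst n u).trans hu)

/-- At a stage `n + 1` with `1 / (n + 1) < tdist u v` the images are still distinct, since `u` lies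
on no collapsed column. From then on their distance keeps at least the positive proportion `l`, also
in the limit. -/
theorem Phi_injOn_X {u v : Torus} (hu : u ∈ D.X) (h : D.Phi α δ u = D.Phi α δ v) : u = v := by
  by_contra hne
  obtain ⟨a, ha, ⟨l, hl, hlim⟩, hexp⟩ := hA.expand
  have hd : 0 < tdist u v := (dist_pos.2 hne).trans_le (dist_le_tdist u v)
  obtain ⟨n, hn⟩ := exists_nat_one_div_lt hd
  have hfac (r : ℕ) : 0 < 1 - 1 / (a r : ℝ) ∧ 1 - 1 / (a r : ℝ) ≤ 1 := by
    have h2 : (2 : ℝ) ≤ a r := by exact_mod_cast ha r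
    have h3 : 1 / (a r : ℝ) ≤ 1 / 2 := one_div_le_one_div_of_le two_pos h2
    have h4 : 0 < 1 / (a r : ℝ) := one_div_pos.2 (by linarith)
    constructor <;> linarith
  have hanti : Antitone fun N => ∏ r ∈ Finset.Icc 1 N, (1 - 1 / (a r : ℝ)) := by
    refine antitone_nat_of_succ_le fun N => ?_
    rw [Finset.prod_Icc_succ_top (by omega)]
    exact mul_le_of_le_one_right (Finset.prod_nonneg fun r _ => (hfac r).1.le) (hfac _).2
  have hprod (m : ℕ) (hm : n + 1 ≤ m) : l ≤ ∏ r ∈ Finset.Ioc (n + 1) m, (1 - 1 / (a r : ℝ)) := by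
    -- The partial products decrease to `l`, and dropping initial factors, all at most `1`, only
    -- enlarges them.
    have h₁ : l ≤ ∏ r ∈ Finset.Ioc 0 m, (1 - 1 / (a r : ℝ)) := hanti.le_of_tendsto hlim m
    rw [← Finset.prod_Ioc_consecutive _ (Nat.zero_le (n + 1)) hm] at h₁
    exact h₁.trans (mul_le_of_le_one_left (Finset.prod_nonneg fun r _ => (hfac r).1.le)
      (Finset.prod_le_one (fun r _ => (hfac r).1.le) fun r _ => (hfac r).2))
  have hPhi : 0 < tdist (D.PhiN α δ (n + 1) u) (D.PhiN α δ (n + 1) v) := by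
    refine (dist_pos.2 fun e => ?_).trans_le (dist_le_tdist _ _)
    rcases hA.PhiN_inj _ e with e | ⟨m, -, e⟩
    · exact hne e
    · exact hu m e
  have hge : l * tdist (D.PhiN α δ (n + 1) u) (D.PhiN α δ (n + 1) v) ≤
      tdist (D.Phi α δ u) (D.Phi α δ v) := by
    have ht : Tendsto (fun m => tdist (D.PhiN α δ m u) (D.PhiN α δ m v)) atTop
        (𝓝 (tdist (D.Phi α δ u) (D.Phi α δ v))) :=
      tendsto_tdist (hA.tendsto_PhiN u) (hA.tendsto_PhiN v)
    refine ge_of_tendsto ht ?_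
    filter_upwards [eventually_gt_atTop (n + 1)] with m hm
    refine le_trans ?_ (hexp (n + 1) (by omega) u v (by push_cast; exact hn.le) m hm)
    exact mul_le_mul_of_nonneg_right (hprod m hm.le) hPhi.le
  rw [h, tdist_of_fst_eq rfl, dist_self] at hge
  exact (mul_pos hl hPhi).not_ge hge

theorem blowup : D.Blowup (D.Phi α δ) where
  continuous := hA.continuous_Phi
  fst := hA.Phi_fst
  inj u v h := by
    by_cases hu : u ∈ D.X
    · exact Or.inl (hA.Phi_injOn_X hu h)
    · simp only [X, mem_ofPred_eq, not_forall, not_not] at hu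
      obtain ⟨n, hn⟩ := hu
      have hv : v.1 = (D.z n).1 := by rw [← hA.Phi_fst v, ← h, hA.Phi_fst u, hn]
      rw [hA.Phi_eq_PhiN hn, hA.Phi_eq_PhiN hv] at h
      rw [hA.Phi_eq_PhiN hn]
      rcases n with _ | n
      · exact (D.Lam_inj α (hA.pos _) (hA.lt_half _) h).imp id fun e => ⟨0, e⟩
      · rcases D.Lam_inj α (hA.pos _) (hA.lt_half _) h with e | e
        · rcases hA.PhiN_inj _ e with e | ⟨m, hm, e⟩
          · exact Or.inl e
          · exact (hA.z_fst_ne (by omega : m ≠ n + 1) (e.symm.trans hn)).elim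
        · exact Or.inr ⟨n + 1, e⟩
  small ε hε := by
    obtain ⟨N, hN⟩ := exists_nat_one_div_lt hε
    refine ⟨N + 1, fun n hn u v hu hv => ?_⟩
    obtain ⟨k, rfl⟩ : ∃ k, n = k + 1 := ⟨n - 1, by omega⟩
    have hu₁ : u.1 = (D.z (k + 1)).1 := by rw [← hA.Phi_fst u, hu]
    have hv₁ : v.1 = (D.z (k + 1)).1 := by rw [← hA.Phi_fst v, hv]
    rw [hA.Phi_eq_PhiN hu₁] at hu
    rw [hA.Phi_eq_PhiN hv₁] at hv
    have hu₂ : dist (D.PhiN α δ k u) (D.z (k + 1)) ≤ δ (k + 1) / 2 := D.dist_le_of_Lam_eq α (hA.pos _) (hA.lt_half _)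
        hu
    have hv₂ : dist (D.PhiN α δ k v) (D.z (k + 1)) ≤ δ (k + 1) / 2 := D.dist_le_of_Lam_eq α (hA.pos _) (hA.lt_half _)
        hv
    have hle : tdist (D.PhiN α δ k u) (D.PhiN α δ k v) ≤ δ (k + 1) := by
      rw [tdist_of_fst_eq (by rw [PhiN_fst, PhiN_fst, hu₁, hv₁])]
      have h₁ := dist_triangle_right (D.PhiN α δ k u) (D.PhiN α δ k v) (D.z (k + 1))
      have h₂ : dist (D.PhiN α δ k u).2 (D.PhiN α δ k v).2 ≤
        dist (D.PhiN α δ k u) (D.PhiN α δ k v) := le_max_right _ _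
      linarith
    calc dist u v ≤ tdist u v := dist_le_tdist u v
      _ < 1 / ((k : ℝ) + 1) := hA.fibre k u v hu₁ hv₁ hle
      _ ≤ 1 / ((N : ℝ) + 1) := by
        refine one_div_le_one_div_of_le (by positivity) ?_
        have : (N : ℝ) ≤ k := by exact_mod_cast (by omega : N ≤ k)
        linarith
      _ < ε := hN
  nontrivial := by
    obtain ⟨u, v, hne, hu, hv⟩ := D.exists_ne_Lam_eq α (hA.pos 0) (hA.lt_half 0) 0
    refine ⟨u, v, hne, ?_, ?_⟩
    · rw [hA.Phi_eq_PhiN (n := 0) (by rw [← hu, Lam_fst])]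
      exact hu
    · rw [hA.Phi_eq_PhiN (n := 0) (by rw [← hv, Lam_fst])]
      exact hv

/-! ### Reordered products and the extension to a homeomorphism. -/

theorem Lam_comm {m n : ℕ} (h : m ≠ n) (h₁ : n ≤ m + 5) (h₂ : m ≤ n + 5) :
    D.Lam α (δ m) m ∘ D.Lam α (δ n) n = D.Lam α (δ n) n ∘ D.Lam α (δ m) m := by
  refine D.Lam_comm α (hA.pos _) (hA.lt_half _) (hA.pos _) (hA.lt_half _) ?_
  rcases lt_or_gt_of_ne h with h | h
  · exact hA.disjoint m n h h₁
  · exact (hA.disjoint n m h h₂).symm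

/-- The values of `sigma` on `0, …, 2k+1` are `0, …, 2k` and `2k+2`. In the induction the new factor
`2k+1` moves past `2k+4` and `2k+2`, indices close enough to commute. -/
theorem PhiAlong_sigma (k : ℕ) : D.PhiAlong α δ sigma (2 * k + 1) =
    D.Lam α (δ (2 * k + 2)) (2 * k + 2) ∘ D.PhiN α δ (2 * k) := by
  induction k with
  | zero => exact hA.Lam_comm (m := 0) (n := 2) (by omega) (by omega) (by omega)
  | succ k ih =>
    have h₁ := (sigma_values (k + 1)).1
    have h₂ := (sigma_values k).2
    rw [show 2 * (k + 1) = 2 * k + 2 by ring] at h₁ ⊢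
    rw [PhiAlong_succ, PhiAlong_succ, ih, h₁, h₂, PhiN_succ, PhiN_succ, ← Function.comp_assoc,
      hA.Lam_comm (by omega) (by omega) (by omega), Function.comp_assoc, ← Function.comp_assoc _ _
      (D.PhiN α δ (2 * k)), hA.Lam_comm (by omega) (by omega) (by omega)]
    rfl

theorem PhiAlong_tau (k : ℕ) : D.PhiAlong α δ tau (2 * k + 2) =
    D.Lam α (δ (2 * k + 3)) (2 * k + 3) ∘ D.PhiN α δ (2 * k + 1) := by
  induction k with
  | zero =>
    have e : D.PhiAlong α δ tau 2 =
      (D.Lam α (δ 0) 0 ∘ D.Lam α (δ 3) 3) ∘ D.Lam α (δ 1) 1 := rfl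
    rw [show 2 * 0 + 2 = 2 from rfl, e, hA.Lam_comm (by omega) (by omega) (by omega),
      Function.comp_assoc, hA.Lam_comm (m := 0) (n := 1) (by omega) (by omega) (by omega)]
    rfl
  | succ k ih =>
    have h₁ := (tau_values (k + 1)).1
    have h₂ := (tau_values (k + 1)).2
    rw [show 2 * (k + 1) = 2 * k + 2 by ring] at h₁ h₂ ⊢
    rw [PhiAlong_succ, PhiAlong_succ, ih, h₁, h₂, PhiN_succ (2 * k + 2), PhiN_succ (2 * k + 1),
      ← Function.comp_assoc, hA.Lam_comm (by omega) (by omega) (by omega), Function.comp_assoc,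
      ← Function.comp_assoc _ _ (D.PhiN α δ (2 * k + 1)), hA.Lam_comm (by omega) (by omega) (by omega)]
    rfl

omit hA in
-- The uniform limit on `X` is uniformly continuous, so it extends from this dense set to the
-- complete torus.
theorem exists_limit {f : ℕ → Torus → Torus} (h : ∀ n, UniformContinuousOn (f n) D.X)
    (hc : UniformCauchySeqOn f atTop D.X) :
    ∃ F : Torus → Torus, Continuous F ∧
      ∀ u ∈ D.X, Tendsto (fun n => f n u) atTop (𝓝 (F u)) := by
  have hex (u : Torus) (hu : u ∈ D.X) : ∃ y, Tendsto (fun n => f n u) atTop (𝓝 y) :=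
    cauchySeq_tendsto_of_complete (hc.cauchySeq hu)
  choose! g hg using hex
  have hu : UniformContinuousOn g D.X :=
    (hc.tendstoUniformlyOn_of_tendsto hg).uniformContinuousOn (Frequently.of_forall h)
  rw [uniformContinuousOn_iff_restrict] at hu
  refine ⟨D.dense_X.extend (D.X.domRestrict g), (D.dense_X.uniformContinuous_extend hu).continuous,
    fun u hu' => ?_⟩
  have := D.dense_X.extend_of_ind hu ⟨u, hu'⟩
  rw [this]
  exact hg u hu'

theorem dist_Lam_PhiN_le (m n : ℕ) (hmn : n ≤ m) (w : Torus) :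
    dist (D.Lam α (δ m) m (D.PhiN α δ n w)) (D.Phi α δ w) ≤ 2 * (2 / 2 ^ n) := by
  have h₁ := D.dist_Lam_le α (hA.pos m) (hA.lt_half m) m (D.PhiN α δ n w)
  have h₂ := hA.dist_PhiN_Phi_le n w
  have h₃ : δ m ≤ 1 / 2 ^ n := (hA.lt_pow m).le.trans
    (one_div_le_one_div_of_le (by positivity) (pow_le_pow_right₀ one_le_two hmn))
  have h₄ : (2 : ℝ) / 2 ^ n = 2 * (1 / 2 ^ n) := by ring
  linarith [dist_triangle (D.Lam α (δ m) m (D.PhiN α δ n w)) (D.PhiN α δ n w) (D.Phi α δ w)]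

/-- Covers `T` with `sigma` and `T⁻¹` with `tau` at once. The full sequence converges to `F u`, so
it suffices to compare along the indices `ind k`, where the reordered product is uniformly close to
`Phi`. -/
theorem semiconj_of_tendsto {R : Torus → Torus} (hR : Continuous R)
    (hRX : ∀ w ∈ D.X, R w ∈ D.X) {e ind lo hi : ℕ → ℕ} (hlo : Tendsto lo atTop atTop)
    (hind : Tendsto ind atTop atTop) (hlh : ∀ k, lo k ≤ hi k)
    (he : ∀ k, D.PhiAlong α δ e (ind k) = D.Lam α (δ (hi k)) (hi k) ∘ D.PhiN α δ (lo k))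
    {F : Torus → Torus} (hF : Continuous F)
    (hlim : ∀ u ∈ D.X, Tendsto (fun n => Function.invFunOn (D.PhiAlong α δ e n) D.X
      (R (D.PhiN α δ n u))) atTop (𝓝 (F u))) (u : Torus) :
    D.Phi α δ (F u) = R (D.Phi α δ u) := by
  refine congrFun (Continuous.ext_on D.dense_X (hA.continuous_Phi.comp hF)
    (hR.comp hA.continuous_Phi) fun u hu => ?_) u
  set f := fun n => Function.invFunOn (D.PhiAlong α δ e n) D.X (R (D.PhiN α δ n u)) with hf
  have h₁ : Tendsto (fun k => D.Phi α δ (f (ind k))) atTop (𝓝 (D.Phi α δ (F u))) :=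
    (hA.continuous_Phi.tendsto _).comp ((hlim u hu).comp hind)
  have h₂ : Tendsto (fun k => R (D.PhiN α δ (ind k) u)) atTop (𝓝 (R (D.Phi α δ u))) :=
    (hR.tendsto _).comp ((hA.tendsto_PhiN u).comp hind)
  refine tendsto_nhds_unique (h₁.congr_dist ?_) h₂
  have h₃ : Tendsto (fun k => 2 * ((2 : ℝ) / 2 ^ lo k)) atTop (𝓝 0) := by
    simpa using (tendsto_two_div_pow.comp hlo).const_mul 2
  refine squeeze_zero (fun _ => dist_nonneg) (fun k => ?_) h₃
  have hX : R (D.PhiN α δ (ind k) u) ∈ D.X :=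
    hRX _ ((D.mem_X_iff_of_fst_eq (PhiN_fst _ u)).2 hu)
  have h₄ : D.PhiAlong α δ e (ind k) (f (ind k)) = R (D.PhiN α δ (ind k) u) :=
    hA.PhiAlong_invFunOn e (ind k) hX
  rw [← h₄, he, dist_comm]
  exact hA.dist_Lam_PhiN_le _ _ (hlh k) _

theorem isExtension_iff (S : Torus ≃ₜ Torus) :
    D.IsExtension α δ S ↔ ∀ u, D.Phi α δ (S u) = D.T (D.Phi α δ u) := by
  have hX (u : Torus) : D.Phi α δ u ∈ D.X ↔ u ∈ D.X := D.mem_X_iff_of_fst_eq (hA.Phi_fst u)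
  have hspec (u : Torus) (hu : u ∈ D.X) :
      Function.invFunOn (D.Phi α δ) D.X (D.T (D.Phi α δ u)) ∈ D.X ∧
      D.Phi α δ (Function.invFunOn (D.Phi α δ) D.X (D.T (D.Phi α δ u))) = D.T (D.Phi α δ u) := by
    obtain ⟨y, hy⟩ := hA.surjective_Phi (D.T (D.Phi α δ u))
    have hyX : y ∈ D.X := by
      rw [← hX, hy]
      exact D.T_mem_X ((hX u).2 hu)
    have hex : ∃ y ∈ D.X, D.Phi α δ y = D.T (D.Phi α δ u) := ⟨y, hyX, hy⟩
    exact ⟨Function.invFunOn_mem hex, Function.invFunOn_eq hex⟩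
  constructor
  · intro h
    refine fun u => congrFun (Continuous.ext_on D.dense_X (hA.continuous_Phi.comp S.continuous)
      (D.continuous_T.comp hA.continuous_Phi) fun u hu => ?_) u
    simp only [Function.comp_apply]
    rw [h hu]
    exact (hspec u hu).2
  · intro h u hu
    have := hspec u hu
    exact (hA.Phi_injOn_X this.1 (this.2.trans (h u).symm)).symm

theorem existsUnique_extension : ∃! S : Torus ≃ₜ Torus, D.IsExtension α δ S := by
  obtain ⟨F, hF, hFlim⟩ := exists_limit hA.fwd_unif hA.fwd_cauchy
  obtain ⟨B, hB, hBlim⟩ := exists_limit hA.bwd_unif hA.bwd_cauchy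
  have hFT : ∀ u, D.Phi α δ (F u) = D.T (D.Phi α δ u) :=
    hA.semiconj_of_tendsto D.continuous_T (fun _ => D.T_mem_X) (e := sigma)
      (ind := fun k => 2 * k + 1) (lo := fun k => 2 * k) (hi := fun k => 2 * k + 2)
      (tendsto_atTop_mono (fun k => by simp only [id]; omega) tendsto_id)
      (tendsto_atTop_mono (fun k => by simp only [id]; omega) tendsto_id) (fun k => by omega)
      hA.PhiAlong_sigma hF hFlim
  have hBT : ∀ u, D.Phi α δ (B u) = D.Tinv (D.Phi α δ u) :=
    hA.semiconj_of_tendsto D.continuous_Tinv (fun _ => D.Tinv_mem_X) (e := tau)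
      (ind := fun k => 2 * k + 2) (lo := fun k => 2 * k + 1) (hi := fun k => 2 * k + 3)
      (tendsto_atTop_mono (fun k => by simp only [id]; omega) tendsto_id)
      (tendsto_atTop_mono (fun k => by simp only [id]; omega) tendsto_id) (fun k => by omega)
      hA.PhiAlong_tau hB hBlim
  have inv {f g : Torus → Torus} (hf : Continuous f) (hg : Continuous g)
      (h : ∀ u, D.Phi α δ (f (g u)) = D.Phi α δ u) (u : Torus) : f (g u) = u :=
    congrFun (Continuous.ext_on (g := id) D.dense_X (hf.comp hg) continuous_id
      fun u hu => (hA.Phi_injOn_X hu (h u).symm).symm) u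
  let S : Torus ≃ₜ Torus :=
    { toFun := F
      invFun := B
      left_inv := inv hB hF fun u => by rw [hBT, hFT, D.Tinv_T]
      right_inv := inv hF hB fun u => by rw [hFT, hBT, D.T_Tinv]
      continuous_toFun := hF
      continuous_invFun := hB }
  refine ⟨S, (hA.isExtension_iff S).2 hFT, fun S' hS' => ?_⟩
  have hS := (hA.isExtension_iff S).2 hFT
  ext1 u
  exact congrFun (Continuous.ext_on D.dense_X S'.continuous S.continuous
    fun u hu => (hS' hu).trans (hS hu).symm) u

end Admissible

end Setup

end DenjoyRees

/-! ### Sequences with the same convergent subsequences. -/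

theorem continuous_of_isClosed_graph {X Y : Type*} [TopologicalSpace X] [TopologicalSpace Y]
    [CompactSpace Y] {f : X → Y} {R : Set (X × Y)} (hR : IsClosed R)
    (h : ∀ p : X × Y, p ∈ R ↔ p.2 = f p.1) : Continuous f := by
  rw [continuous_iff_isClosed]
  intro C hC
  have e : f ⁻¹' C = Prod.fst '' (R ∩ Prod.snd ⁻¹' C) := by
    ext x
    constructor
    · exact fun hx => ⟨(x, f x), ⟨(h _).2 rfl, hx⟩, rfl⟩
    · rintro ⟨⟨x, y⟩, ⟨hp, hy⟩, rfl⟩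
      obtain rfl : y = f x := (h _).1 hp
      exact hy
  rw [e]
  exact isClosedMap_fst_of_compactSpace _ (hR.inter (hC.preimage continuous_snd))

namespace Ett

theorem symm {X : Type*} [TopologicalSpace X] {u v : ℕ → X} (h : Ett u v) :
    Ett v u := fun r hr => (h r hr).symm

variable {X : Type*} [TopologicalSpace X] [T2Space X] {u v : ℕ → X}

/-- Enumerate `range r ∪ range s` increasingly. Along it `u` still converges to `x`, so `v`
converges too, and both given limits of `v` are limits of subsequences of this one. -/
theorem limit_unique (h : Ett u v) {r s : ℕ → ℕ} (hr : StrictMono r) (hs : StrictMono s)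
    {x y z : X} (hur : Tendsto (u ∘ r) atTop (𝓝 x)) (hus : Tendsto (u ∘ s) atTop (𝓝 x))
    (hvr : Tendsto (v ∘ r) atTop (𝓝 y)) (hvs : Tendsto (v ∘ s) atTop (𝓝 z)) : y = z := by
  classical
  let P : ℕ → Prop := fun n => n ∈ range r ∪ range s
  have hinf : (Set.ofPred P).Infinite :=
    (infinite_range_of_injective hr.injective).mono fun n hn => Or.inl hn
  have ht : StrictMono (Nat.nth P) := Nat.nth_strictMono hinf
  have hut : Tendsto (fun k => u (Nat.nth P k)) atTop (𝓝 x) := by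
    intro U hU
    obtain ⟨K, hK⟩ := eventually_atTop.1 (hur.eventually hU)
    obtain ⟨L, hL⟩ := eventually_atTop.1 (hus.eventually hU)
    rw [mem_map]
    filter_upwards [eventually_ge_atTop (max (r K) (s L))] with k hk
    have hk' := hk.trans (ht.le_apply (x := k))
    change u (Nat.nth P k) ∈ U
    rcases Nat.nth_mem_of_infinite hinf k with ⟨j, hj⟩ | ⟨j, hj⟩
    · rw [← hj] at hk' ⊢
      exact hK j (hr.le_iff_le.1 ((le_max_left _ _).trans hk'))
    · rw [← hj] at hk' ⊢
      exact hL j (hs.le_iff_le.1 ((le_max_right _ _).trans hk'))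
  obtain ⟨b, hb⟩ := (h _ ht).1 ⟨x, hut⟩
  have aux {r : ℕ → ℕ} (hr : StrictMono r) (hP : ∀ k, P (r k)) {y : X}
      (hy : Tendsto (v ∘ r) atTop (𝓝 y)) : y = b := by
    have hc (k : ℕ) : Nat.nth P (Nat.count P (r k)) = r k := Nat.nth_count (hP k)
    have hmono : StrictMono fun k => Nat.count P (r k) := fun i j hij => by
      rw [← ht.lt_iff_lt, hc, hc]
      exact hr hij
    refine tendsto_nhds_unique hy ((hb.comp hmono.tendsto_atTop).congr fun k => ?_)
    simp only [Function.comp_apply, hc]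
  rw [aux hr (fun k => Or.inl (mem_range_self k)) hvr,
    aux hs (fun k => Or.inr (mem_range_self k)) hvs]

theorem mapClusterPt_unique [FirstCountableTopology X] (h : Ett u v) {x y z : X}
    (hy : MapClusterPt (x, y) atTop fun n => (u n, v n))
    (hz : MapClusterPt (x, z) atTop fun n => (u n, v n)) : y = z := by
  obtain ⟨r, hr, hr'⟩ := hy.tendsto_subseq
  obtain ⟨s, hs, hs'⟩ := hz.tendsto_subseq
  exact h.limit_unique hr hs hr'.fst_nhds hs'.fst_nhds hr'.snd_nhds hs'.snd_nhds

omit [T2Space X] in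
theorem exists_mapClusterPt [FirstCountableTopology X] [CompactSpace X] {x : X}
    (hx : MapClusterPt x atTop u) : ∃ y, MapClusterPt (x, y) atTop fun n => (u n, v n) := by
  obtain ⟨r, hr, hr'⟩ := hx.tendsto_subseq
  obtain ⟨y, s, hs, hs'⟩ := CompactSpace.tendsto_subseq (v ∘ r)
  refine ⟨y, MapClusterPt.of_comp (hr.comp hs).tendsto_atTop ?_⟩
  exact ((hr'.comp hs.tendsto_atTop).prodMk_nhds hs').mapClusterPt

/-- Sequences with the same convergent subsequences whose cluster points are all points of a
compact space correspond to each other under a homeomorphism. -/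
theorem exists_homeomorph [FirstCountableTopology X] [CompactSpace X] (h : Ett u v)
    (hu : ∀ x, MapClusterPt x atTop u) (hv : ∀ x, MapClusterPt x atTop v) :
    -- The cluster set of the paired sequence is closed, and by `mapClusterPt_unique` in both
    -- directions it is the graph of a bijection; compactness gives continuity.
    ∃ φ : X ≃ₜ X, ∀ x y, MapClusterPt (x, y) atTop (fun n => (u n, v n)) ↔ y = φ x := by
  have swap {u v : ℕ → X} {x y : X} (h : MapClusterPt (x, y) atTop fun n => (u n, v n)) :
      MapClusterPt (y, x) atTop fun n => (v n, u n) :=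
    h.continuousAt_comp (f := Prod.swap) continuous_swap.continuousAt
  have h' : Ett v u := h.symm
  choose f hf using fun x => exists_mapClusterPt (v := v) (hu x)
  choose g hg using fun x => exists_mapClusterPt (v := u) (hv x)
  have hf' (x y : X) : MapClusterPt (x, y) atTop (fun n => (u n, v n)) ↔ y = f x :=
    ⟨fun hy => h.mapClusterPt_unique hy (hf x), fun e => e ▸ hf x⟩
  have hg' (x y : X) : MapClusterPt (x, y) atTop (fun n => (v n, u n)) ↔ y = g x :=
    ⟨fun hy => h'.mapClusterPt_unique hy (hg x), fun e => e ▸ hg x⟩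
  refine ⟨{ toFun := f
            invFun := g
            left_inv := fun x => ((hg' _ _).1 (swap (hf x))).symm
            right_inv := fun x => ((hf' _ _).1 (swap (hg x))).symm
            continuous_toFun := ?_
            continuous_invFun := ?_ }, hf'⟩
  · exact continuous_of_isClosed_graph isClosed_setOfPred_clusterPt fun p => hf' p.1 p.2
  · exact continuous_of_isClosed_graph isClosed_setOfPred_clusterPt fun p => hg' p.1 p.2

end Ett

theorem ett_of_homeomorph {X : Type*} [PseudoMetricSpace X] (ψ : X ≃ₜ X) {u v : ℕ → X}
    (h : Tendsto (fun n => dist (ψ (u n)) (v n)) atTop (𝓝 0)) : Ett u v := by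
  intro r hr
  have hr' := h.comp hr.tendsto_atTop
  constructor
  · rintro ⟨a, ha⟩
    exact ⟨ψ a, ((ψ.continuous.tendsto a).comp ha).congr_dist hr'⟩
  · rintro ⟨b, hb⟩
    refine ⟨ψ.symm b, ?_⟩
    have h₁ : Tendsto (fun k => ψ (u (r k))) atTop (𝓝 b) :=
      hb.congr_dist (hr'.congr fun k => dist_comm _ _)
    exact ((ψ.symm.continuous.tendsto b).comp h₁).congr fun k => ψ.symm_apply_apply _

/-! ### Conjugacy of two blowups. -/

namespace DenjoyRees.Setup

variable {D : Setup}

/-- Minimality speaks of two-sided orbits; in a compact group the forward multiples of `v` already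
cluster at every point of the closure of all multiples. -/
theorem mapClusterPt_z (y : Torus) : MapClusterPt y atTop fun n => D.z (2 * n) := by
  have h₁ : y - D.z₀ ∈ closure (range fun n : ℤ => n • D.v) := by
    have := D.minimal 0 (y - D.z₀)
    simpa only [zero_add] using this
  have h₂ := ((mapClusterPt_atTop_nsmul_tfae (y - D.z₀) D.v).out 0 3).2 h₁
  have h₃ := h₂.continuousAt_comp (f := fun x => D.z₀ + x) (by fun_prop)
  rw [add_sub_cancel] at h₃
  simp only [z_even]
  exact h₃

namespace Blowup

variable {Φ Ψ : Torus → Torus} (hΦ : D.Blowup Φ) (hΨ : D.Blowup Ψ)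

include hΦ in
theorem mapClusterPt {w : ℕ → Torus} (hw : ∀ n, Φ (w n) = D.z (2 * n)) (x : Torus) :
    MapClusterPt x atTop w := by
  -- Over a point of `X` the fibre is a singleton, so a limit of lifts is forced to be `x`; the
  -- cluster set is closed, hence everything.
  have hX : D.X ⊆ {x | MapClusterPt x atTop w} := by
    intro x hx
    obtain ⟨r, hr, hr'⟩ := (mapClusterPt_z (D := D) (Φ x)).tendsto_subseq
    obtain ⟨u, s, hs, hs'⟩ := CompactSpace.tendsto_subseq (w ∘ r)
    have hu : Φ x = Φ u := by
      refine tendsto_nhds_unique (hr'.comp hs.tendsto_atTop)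
        (((hΦ.continuous.tendsto u).comp hs').congr fun k => ?_)
      exact hw _
    rcases hΦ.inj _ _ hu with rfl | ⟨n, hn⟩
    · exact MapClusterPt.of_comp (hr.comp hs).tendsto_atTop hs'.mapClusterPt
    · exact (hx n (by rw [← hn, hΦ.fst])).elim
  exact closure_minimal hX isClosed_setOfPred_clusterPt (D.dense_X x)

include hΦ in
theorem tendsto_dist {u v : ℕ → Torus} {e : ℕ → ℕ} (he : ∀ n, n ≤ e n)
    (hu : ∀ n, Φ (u n) = D.z (e n)) (hv : ∀ n, Φ (v n) = D.z (e n)) :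
    Tendsto (fun n => dist (u n) (v n)) atTop (𝓝 0) := by
  rw [Metric.tendsto_atTop]
  intro ε hε
  obtain ⟨N, hN⟩ := hΦ.small ε hε
  refine ⟨N, fun n hn => ?_⟩
  rw [Real.dist_0_eq_abs, abs_of_nonneg dist_nonneg]
  exact hN (e n) (hn.trans (he n)) _ _ (hu n) (hv n)

variable {S R : Torus ≃ₜ Torus}

theorem semiconj_z_even {w : ℕ → Torus} (hS : ∀ u, Φ (S u) = D.T (Φ u))
    (hw : ∀ n, Φ (w n) = D.z (2 * n)) (n : ℕ) : Φ (S (w n)) = D.z (2 * (n + 1)) := by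
  rw [hS, hw, z_even, z_even, T, add_assoc, succ_nsmul]

include hΦ hΨ in
theorem conjugate_of_ett (hS : ∀ u, Φ (S u) = D.T (Φ u)) (hR : ∀ u, Ψ (R u) = D.T (Ψ u))
    {w w' : ℕ → Torus} (hw : ∀ n, Φ (w n) = D.z (2 * n)) (hw' : ∀ n, Ψ (w' n) = D.z (2 * n))
    (h : Ett w w') : TopConjugate S R := by
  obtain ⟨φ, hφ⟩ := h.exists_homeomorph (hΦ.mapClusterPt hw) (hΨ.mapClusterPt hw')
  refine ⟨φ, fun x => ((hφ _ _).1 ?_).symm⟩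
  obtain ⟨r, hr, hr'⟩ := ((hφ x (φ x)).2 rfl).tendsto_subseq
  have aux {Φ : Torus → Torus} (hΦ : D.Blowup Φ) {S : Torus ≃ₜ Torus}
      (hS : ∀ u, Φ (S u) = D.T (Φ u)) {w : ℕ → Torus} (hw : ∀ n, Φ (w n) = D.z (2 * n))
      {x : Torus} (hx : Tendsto (fun k => w (r k)) atTop (𝓝 x)) :
      Tendsto (fun k => w (r k + 1)) atTop (𝓝 (S x)) := by
    -- `S (w n)` and `w (n + 1)` lie in the same fibre, over `z (2 * (n + 1))`, and these fibres
    -- shrink.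
    have hd := hΦ.tendsto_dist (u := fun n => S (w n)) (v := fun n => w (n + 1))
      (e := fun n => 2 * (n + 1)) (fun n => by omega) (semiconj_z_even hS hw) fun n => hw (n + 1)
    exact ((S.continuous.tendsto x).comp hx).congr_dist (hd.comp hr.tendsto_atTop)
  refine MapClusterPt.of_comp (φ := fun k => r k + 1) (p := atTop) ?_ ?_
  · exact (tendsto_add_atTop_nat 1).comp hr.tendsto_atTop
  · exact ((aux hΦ hS hw hr'.fst_nhds).prodMk_nhds (aux hΨ hR hw' hr'.snd_nhds)).mapClusterPt

theorem exists_translate (hS : ∀ u, Φ (S u) = D.T (Φ u)) (n : ℕ) :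
    ∃ P : Torus ≃ₜ Torus, ∀ u, Φ (P u) = Φ u + n • D.v := by
  induction n with
  | zero => exact ⟨Homeomorph.refl _, fun u => by simp⟩
  | succ n ih =>
    obtain ⟨P, hP⟩ := ih
    refine ⟨P.trans S, fun u => ?_⟩
    rw [Homeomorph.trans_apply, hS, hP, T, succ_nsmul, add_assoc]

include hΦ hΨ in
theorem exists_lift_of_conjugate (hS : ∀ u, Φ (S u) = D.T (Φ u)) (hR : ∀ u, Ψ (R u) = D.T (Ψ u))
    (h : TopConjugate S R) : ∃ ψ : Torus ≃ₜ Torus, ∀ u, Ψ (ψ u) = Φ u := by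
  obtain ⟨φ, hφ⟩ := h
  obtain ⟨u₀, v₀, hne, hu₀, hv₀⟩ := hΦ.nontrivial
  -- Both systems cover the same translation, so this difference is `S`-invariant; it is constant
  -- because the forward `S`-orbit of `u₀` clusters everywhere.
  set c : Torus → Torus := fun u => Ψ (φ u) - Φ u with hc
  have hcc : Continuous c := (hΨ.continuous.comp φ.continuous).sub hΦ.continuous
  have hinv (u : Torus) : c (S u) = c u := by
    simp only [hc, hφ, hS, hR, T]
    abel
  have horb (n : ℕ) : c (S^[n] u₀) = c u₀ := by
    induction n with
    | zero => rfl
    | succ n ih => rw [Function.iterate_succ_apply', hinv, ih]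
  have hz (n : ℕ) : Φ (S^[n] u₀) = D.z (2 * n) := by
    induction n with
    | zero => exact hu₀
    | succ n ih => rw [Function.iterate_succ_apply', hS, ih, z_even, z_even, T, add_assoc, succ_nsmul]
  have hconst (u : Torus) : c u = c u₀ := by
    obtain ⟨r, hr, hr'⟩ := (hΦ.mapClusterPt hz u).tendsto_subseq
    refine tendsto_nhds_unique ((hcc.tendsto u).comp hr') (tendsto_const_nhds.congr fun k => ?_)
    exact (horb _).symm
  have hΨφ (u : Torus) : Ψ (φ u) = Φ u + c u₀ := by
    rw [← hconst u]
    simp [hc]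
  -- `φ u₀ ≠ φ v₀` have the same image under `Ψ`, so that image is an orbit point and the constant
  -- is a multiple of `v`. The parity of `k` gives its sign, hence whether `R` or its inverse is
  -- iterated.
  obtain ⟨k, hk⟩ : ∃ k, Ψ (φ u₀) = D.z k := by
    refine (hΨ.inj (φ u₀) (φ v₀) ?_).resolve_left (φ.injective.ne hne)
    rw [hΨφ, hΨφ, hu₀, hv₀]
  rw [hΨφ, hu₀, show (0 : ℕ) = 2 * 0 from rfl, z_even, zero_nsmul, add_zero] at hk
  obtain ⟨i, rfl | rfl⟩ := Nat.even_or_odd' k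
  · obtain ⟨P, hP⟩ := exists_translate hR i
    refine ⟨φ.trans P.symm, fun u => ?_⟩
    have h₁ := hP (P.symm (φ u))
    rw [P.apply_symm_apply, hΨφ] at h₁
    rw [z_even, add_right_inj] at hk
    rw [hk] at h₁
    exact (add_right_cancel h₁).symm
  · obtain ⟨P, hP⟩ := exists_translate hR (i + 1)
    refine ⟨φ.trans P, fun u => ?_⟩
    rw [z_odd, sub_eq_add_neg, add_right_inj] at hk
    rw [Homeomorph.trans_apply, hP, hΨφ, hk, neg_add_cancel_right]

include hΦ hΨ in
theorem conjugate_iff_ett (hS : ∀ u, Φ (S u) = D.T (Φ u)) (hR : ∀ u, Ψ (R u) = D.T (Ψ u))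
    {w w' : ℕ → Torus} (hw : ∀ n, Φ (w n) = D.z (2 * n)) (hw' : ∀ n, Ψ (w' n) = D.z (2 * n)) :
    TopConjugate S R ↔ Ett w w' := by
  refine ⟨fun h => ?_, hΦ.conjugate_of_ett hΨ hS hR hw hw'⟩
  obtain ⟨ψ, hψ⟩ := hΦ.exists_lift_of_conjugate hΨ hS hR h
  exact ett_of_homeomorph ψ (hΨ.tendsto_dist (e := fun n => 2 * n) (fun n => by omega)
    (fun n => by rw [hψ, hw]) hw')

end Blowup

end DenjoyRees.Setup

theorem mainTheorem5 (D : DenjoyRees.Setup) (α β : ℕ → unitInterval) (δα δβ : ℕ → ℝ)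
    (hα : D.Admissible α δα) (hβ : D.Admissible β δβ) :
    (∃! Sα : DenjoyRees.Torus ≃ₜ DenjoyRees.Torus, D.IsExtension α δα Sα) ∧
    (∃! Sβ : DenjoyRees.Torus ≃ₜ DenjoyRees.Torus, D.IsExtension β δβ Sβ) ∧
    ∀ Sα Sβ : DenjoyRees.Torus ≃ₜ DenjoyRees.Torus,
      D.IsExtension α δα Sα → D.IsExtension β δβ Sβ →
      ∀ w w' : ℕ → DenjoyRees.Torus,
        (∀ n, D.Phi α δα (w n) = D.z (2 * n)) →
        (∀ n, D.Phi β δβ (w' n) = D.z (2 * n)) →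
        (TopConjugate Sα Sβ ↔ Ett w w') :=
  ⟨hα.existsUnique_extension, hβ.existsUnique_extension, fun Sα Sβ hSα hSβ _ _ hw hw' =>
    hα.blowup.conjugate_iff_ett hβ.blowup ((hα.isExtension_iff Sα).1 hSα)
      ((hβ.isExtension_iff Sβ).1 hSβ) hw hw'⟩
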